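/- **Setting.** Let $d\in\{2,3\}$, let $K,B,C,c,B_0,q>0$ and $A,a,b\in\mathbb R$, with $A<0$ if $d=2$ and $A<\frac{B^2}{27C}$ if $d=3$, and put $s_+=\sqrt{-2A/C}$ if $d=2$, $s_+=\frac{B+\sqrt{B^2-24AC}}{4C}$ if $d=3$. On the periodic uniform mesh with $J\ge 1$ cells of size $h=L_d/J$ in each of the $d$ directions let $D_k^{+},D_k^-,D_k^c$ be the forward, backward and central differences, $\Delta_h=\sum_k D_k^+D_k^-$, $D_h^2u=(D_k^cD_l^cu)_{k,l}$, $\nabla_h\cdot$ the divergence formed with $D_k^-$, $\langle U,V\rangle_h=h^d\sum_x U(x)V(x)$ (sum over one period; summed over components for tensors), $|\cdot|_F$ the Frobenius norm and $\|\Phi\|_\infty=\max_x|\Phi(x)|_F$. For a symmetric traceless $d\times d$ tensor grid function $Q$, a scalar grid function $u$ and $s\in\mathbb R$ put $M=\frac{Q}{s_+}+\frac{I}{d}$ and $$E_{1h}(Q,u)=2B_0q^2\langle D_h^2u,Mu\rangle_h+B_0q^4\|Mu\|_h^2+\langle f_{bn}(Q),1\rangle_h+\langle f_s(u),1\rangle_h,\qquad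 g(Q,u,s)=\frac{e^{s}}{e^{E_{1h}(Q,u)}},$$ where $f_{bn}(Q)=\frac A2\operatorname{tr}Q^2+\frac C4(\operatorname{tr}Q^2)^2$ for $d=2$, with the additional term $-\frac B3\operatorname{tr}Q^3$ for $d=3$, and $f_s(u)=\frac a2u^2+\frac b3u^3+\frac c4u^4$. Put further $$\mathbf T(u)=\tfrac{2B_0q^2}{s_+}\Big(u\,D_h^2u-\tfrac{\operatorname{tr}(u D_h^2u)}{d}I\Big),\qquad \tilde A(u)=A+\tfrac{2B_0q^4}{s_+^2}u^2,$$ $$H(Q,u)=\tilde A(u)\,Q-B\Big(Q^2-\tfrac{\operatorname{tr}Q^2}{d}I\Big)+C\operatorname{tr}(Q^2)\,Q+\mathbf T(u),$$ $$\mu(Q,u)=au+bu^2+cu^3+2B_0q^2\,M:D_h^2u+2B_0q^2\,\nabla_h\cdot(\nabla_h\cdot(Mu))+2B_0q^4|M|_F^2u .$$ **Scheme.** Fix $\eta_0\in[0,1]$, a symmetric traceless $Q_h^0$, and $u_h^0$, and put $s^0=E_{1h}(Q_h^0,u_h^0)$. For a time step $\tau>0$ and stabilization constants $\kappa_1,\kappa_2>0$,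 a numerical solution is a sequence $(Q_h^n,u_h^n,s^n)_{n\ge0}$ such that, with $g^n=g(Q_h^n,u_h^n,s^n)$, $\mathcal L=-K\Delta_h+g^n\kappa_1$, $\mathcal D=2B_0\Delta_h^2+g^n\kappa_2$, $H^n=H(Q_h^n,u_h^n)$, $\mu^n=\mu(Q_h^n,u_h^n)$ and $\phi_1(z)=(e^z-1)/z$, $$Q_h^{n+1}=e^{-\tau\mathcal L}Q_h^n+\tau\phi_1(-\tau\mathcal L)\big(-g^nH^n+g^n\kappa_1Q_h^n\big),\qquad u_h^{n+1}=e^{-\tau\mathcal D}u_h^n+\tau\phi_1(-\tau\mathcal D)\big(-g^n\mu^n+g^n\kappa_2u_h^n\big),$$ $$\tilde s^{n+1}=s^n+g^n\big(\langle H^n,\delta Q^{n+1}\rangle_h+\langle\mu^n,\delta u^{n+1}\rangle_h\big),\qquad s^{n+1}=\xi\tilde s^{n+1}+(1-\xi)E_{1h}(Q_h^{n+1},u_h^{n+1}),$$ where $\delta Q^{n+1}=Q_h^{n+1}-Q_h^n$, $\delta u^{n+1}=u_h^{n+1}-u_h^n$ and $\xi=\xi^{n+1}\in[0,1]$ is any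 number with $s^{n+1}-\tilde s^{n+1}\le\eta_0\tau\mathcal R^{n+1}$; here $\mathcal R^{n+1}=\frac1\tau\big(\langle\mathcal Q_1(\tau\mathcal L)\delta Q^{n+1},\delta Q^{n+1}\rangle_h+\langle\mathcal Q_1(\tau\mathcal D)\delta u^{n+1},\delta u^{n+1}\rangle_h\big)$ and $\mathcal Q_1(z)=\frac z{e^z-1}+\frac z2$. **Constants.** We say that $G_*>0$, $S$ and $\bar A$ are bounds at level $n$ if $g^n\ge G_*$, $\|\mathbf T(u_h^n)\|_\infty\le S$ and $\sup_x\tilde A(u_h^n)(x)\le\bar A$. With $b_2=0$, $b_3=|B|/\sqrt6$ put $f_d(\xi)=-A\xi+b_d\xi^2-C\xi^3+S$ and $$\kappa_0=\max\Big\{\bar A+C\eta^2,\ \max_{\xi\in[0,\eta]}\big(A-2b_d\xi+3C\xi^2\big)\Big\}.$$ **Theorem (maximum bound principle).** 1. For every $T>0$ there are $G_*>0$, $S$, $\bar A$, independent of $\tau$, $\kappa_1$, $\kappa_2$ and $n$, which are bounds at every level $n$ with $n\tau\le T$, for every numerical solution with these initial data. 2. For every $S$, all sufficiently large $\eta$ satisfy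 $f_d(\eta)\le0$. 3. Let $\tau,\kappa_1,\kappa_2>0$ be arbitrary, let $(Q_h^n,u_h^n,s^n)$ be a numerical solution, let $N\in\{0,1,2,\dots\}\cup\{\infty\}$, and let $G_*>0,S,\bar A$ be bounds at all levels $n<N$. If $\eta>0$ satisfies $f_d(\eta)\le0$, $\|Q_h^0\|_\infty\le\eta$ and $\kappa_1\ge\kappa_0/G_*$, then $$\|Q_h^n\|_\infty\le\eta\qquad\text{for all }0\le n\le N,\ n<\infty.$$ -/

import Mathlib

namespace Smectic

noncomputable section

/-- Nodes of the uniform periodic mesh with `J` cells in each of the `d` directions. -/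
abbrev Grid (d J : ℕ) := Fin d → ZMod J

/-- Periodic scalar grid functions. -/
abbrev Scalar (d J : ℕ) := Grid d J → ℝ

/-- Periodic `d × d` tensor-valued grid functions. -/
abbrev Tensor (d J : ℕ) := Grid d J → Matrix (Fin d) (Fin d) ℝ

/-- Linear operators on scalar grid functions. -/
abbrev Op (d J : ℕ) := Scalar d J →L[ℝ] Scalar d J

/-- Symmetric traceless tensor grid functions. -/
def IsQTensor {d J : ℕ} (Q : Tensor d J) : Prop :=
  ∀ x, (Q x).IsSymm ∧ (Q x).trace = 0

/-! ### Finite differences -/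

section Differences

variable {d J : ℕ} [NeZero J]

/-- `(shift k r U) x = U (x + r e_k)`. -/
def shift (k : Fin d) (r : ZMod J) : Scalar d J →ₗ[ℝ] Scalar d J :=
  LinearMap.funLeft ℝ ℝ (fun x : Grid d J => x + Pi.single k r)

/-- Forward difference. -/
def dPlus (h : ℝ) (k : Fin d) : Scalar d J →ₗ[ℝ] Scalar d J :=
  h⁻¹ • (shift k 1 - LinearMap.id)

/-- Backward difference. -/
def dMinus (h : ℝ) (k : Fin d) : Scalar d J →ₗ[ℝ] Scalar d J :=
  h⁻¹ • (LinearMap.id - shift k (-1))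

/-- Central difference. -/
def dCentral (h : ℝ) (k : Fin d) : Scalar d J →ₗ[ℝ] Scalar d J :=
  (2 * h)⁻¹ • (shift k 1 - shift k (-1))

/-- Discrete Laplacian `∑ₖ Dₖ⁺ Dₖ⁻`. -/
def laplacian (h : ℝ) : Op d J :=
  LinearMap.toContinuousLinearMap (∑ k : Fin d, dPlus h k ∘ₗ dMinus h k)

/-- Discrete Hessian, with entries `Dₖᶜ Dₗᶜ u`. -/
def hessian (h : ℝ) (u : Scalar d J) : Tensor d J :=
  fun x => Matrix.of fun k l => dCentral h k (dCentral h l u) x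

/-- `∇_h · (∇_h · Φ)`, with the backward-difference divergence. -/
def divDiv (h : ℝ) (Φ : Tensor d J) : Scalar d J :=
  ∑ k : Fin d, dMinus h k (∑ l : Fin d, dMinus h l (fun x => Φ x k l))

/-- Discrete inner product of scalar grid functions (sum over one full period). -/
def inner (h : ℝ) (U V : Scalar d J) : ℝ := h ^ d * ∑ x, U x * V x

/-- Discrete Frobenius inner product of tensor grid functions. -/
def innerT (h : ℝ) (Φ Ψ : Tensor d J) : ℝ :=
  ∑ i, ∑ j, inner h (fun x => Φ x i j) (fun x => Ψ x i j)

/-- An operator on scalar grid functions acting on every component of a tensor. -/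
def Op.onTensor (L : Op d J) (Φ : Tensor d J) : Tensor d J :=
  fun x => Matrix.of fun i j => L (fun y => Φ y i j) x

end Differences

/-- Frobenius norm of a matrix. -/
def frob {d : ℕ} (M : Matrix (Fin d) (Fin d) ℝ) : ℝ := √(∑ i, ∑ j, M i j ^ 2)

/-- `‖Φ‖_∞`, the maximum over the mesh of the pointwise Frobenius norm. -/
def supNorm {d J : ℕ} [NeZero J] (Φ : Tensor d J) : ℝ :=
  Finset.univ.sup' Finset.univ_nonempty fun x => frob (Φ x)

/-! ### Operator functions -/

section OperatorFunctions

variable {d J : ℕ} [NeZero J]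

/-- `φ₁(z) = (e^z - 1) / z` at an invertible operator. -/
def phi1 (Z : Op d J) : Op d J := Ring.inverse Z * (NormedSpace.exp Z - 1)

/-- `𝒬(z) = z / (e^z - 1)` at an operator `Z` for which `e^Z - 1` is invertible. -/
def calQ (Z : Op d J) : Op d J := Z * Ring.inverse (NormedSpace.exp Z - 1)

/-- `𝒬₁(z) = z / (e^z - 1) + z / 2`. -/
def calQ1 (Z : Op d J) : Op d J := calQ Z + (1 / 2 : ℝ) • Z

end OperatorFunctions

/-! ### The model -/

/-- Physical parameters: elastic constant `K`, nematic bulk constants `A, B, C`, smectic bulk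
constants `a, b, c`, coupling strength `B0`, wave number `q`. -/
structure Params where
  (K A B C a b c B0 q : ℝ)

namespace Params

/-- Sign conditions, in the regime in which `Q` and `u` are coupled and `s₊` is defined. -/
structure Admissible (p : Params) (d : ℕ) : Prop where
  K_pos : 0 < p.K
  B_pos : 0 < p.B
  C_pos : 0 < p.C
  c_pos : 0 < p.c
  B0_pos : 0 < p.B0
  q_pos : 0 < p.q
  regime : (d = 2 ∧ p.A < 0) ∨ (d = 3 ∧ p.A < p.B ^ 2 / (27 * p.C))

/-- The reference order parameter `s₊` (`d = 2` or `d = 3`). -/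
def sPlus (p : Params) (d : ℕ) : ℝ :=
  if d = 2 then √(-2 * p.A / p.C)
  else (p.B + √(p.B ^ 2 - 24 * p.A * p.C)) / (4 * p.C)

/-- Nematic bulk energy density. -/
def fbn (p : Params) {d : ℕ} (M : Matrix (Fin d) (Fin d) ℝ) : ℝ :=
  if d = 2 then p.A / 2 * (M ^ 2).trace + p.C / 4 * (M ^ 2).trace ^ 2
  else p.A / 2 * (M ^ 2).trace - p.B / 3 * (M ^ 3).trace + p.C / 4 * (M ^ 2).trace ^ 2

/-- Smectic bulk energy density. -/
def fs (p : Params) (v : ℝ) : ℝ := p.a / 2 * v ^ 2 + p.b / 3 * v ^ 3 + p.c / 4 * v ^ 4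

variable {d J : ℕ} [NeZero J]

/-- `M = Q / s₊ + I / d`. -/
def orient (p : Params) (Q : Tensor d J) : Tensor d J :=
  fun x => (p.sPlus d)⁻¹ • Q x + (d : ℝ)⁻¹ • (1 : Matrix (Fin d) (Fin d) ℝ)

/-- The discrete nonlinear energy `E_{1h}`. -/
def energy1 (p : Params) (h : ℝ) (Q : Tensor d J) (u : Scalar d J) : ℝ :=
  2 * p.B0 * p.q ^ 2 * innerT h (hessian h u) (fun x => u x • p.orient Q x)
    + p.B0 * p.q ^ 4 * innerT h (fun x => u x • p.orient Q x) (fun x => u x • p.orient Q x)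
    + inner h (fun x => p.fbn (Q x)) 1 + inner h (fun x => p.fs (u x)) 1

/-- The factor `g = exp(s) / exp(E_{1h}(Q, u))`. -/
def gFactor (p : Params) (h : ℝ) (Q : Tensor d J) (u : Scalar d J) (s : ℝ) : ℝ :=
  Real.exp s / Real.exp (p.energy1 h Q u)

/-- The forcing term `(2 B₀ q² / s₊) (u D²u - tr(u D²u)/d I)`. -/
def forcing (p : Params) (h : ℝ) (u : Scalar d J) : Tensor d J :=
  fun x => (2 * p.B0 * p.q ^ 2 / p.sPlus d) •
    (u x • hessian h u x
      - ((u x • hessian h u x).trace / (d : ℝ)) • (1 : Matrix (Fin d) (Fin d) ℝ))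

/-- The nonlinear variation with respect to `Q`. -/
def varQ (p : Params) (h : ℝ) (Q : Tensor d J) (u : Scalar d J) : Tensor d J :=
  fun x => p.A • Q x
    - p.B • (Q x ^ 2 - ((Q x ^ 2).trace / (d : ℝ)) • (1 : Matrix (Fin d) (Fin d) ℝ))
    + (p.C * (Q x ^ 2).trace) • Q x
    + p.forcing h u x
    + (2 * p.B0 * p.q ^ 4 / p.sPlus d ^ 2 * u x ^ 2) • Q x

/-- The nonlinear variation with respect to `u`. -/
def varU (p : Params) (h : ℝ) (Q : Tensor d J) (u : Scalar d J) : Scalar d J :=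
  fun x => p.a * u x + p.b * u x ^ 2 + p.c * u x ^ 3
    + 2 * p.B0 * p.q ^ 2 * ∑ i, ∑ j, p.orient Q x i j * hessian h u x i j
    + 2 * p.B0 * p.q ^ 2 * divDiv h (fun y => u y • p.orient Q y) x
    + 2 * p.B0 * p.q ^ 4 * (∑ i, ∑ j, p.orient Q x i j ^ 2) * u x

/-- `ℒ_h = -K Δ_h + g κ₁`. -/
def opQ (p : Params) (h g κ₁ : ℝ) : Op d J := -(p.K • laplacian h) + (g * κ₁) • (1 : Op d J)

/-- `𝒟_h = 2 B₀ Δ_h² + g κ₂`. -/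
def opU (p : Params) (h g κ₂ : ℝ) : Op d J :=
  (2 * p.B0) • (laplacian h * laplacian h) + (g * κ₂) • (1 : Op d J)

/-- One step of the exponential integrator for `Q`:
`e^{-τℒ} Q + τ φ₁(-τℒ) N` with `N = -g H + g κ₁ Q`. -/
def stepQ (p : Params) (h τ κ₁ : ℝ) (Q : Tensor d J) (u : Scalar d J) (s : ℝ) : Tensor d J :=
  let g := p.gFactor h Q u s
  let L : Op d J := p.opQ h g κ₁
  Op.onTensor (NormedSpace.exp (-(τ • L))) Q
    + τ • Op.onTensor (phi1 (-(τ • L))) (-(g • p.varQ h Q u) + (g * κ₁) • Q)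

/-- One step of the exponential integrator for `u`. -/
def stepU (p : Params) (h τ κ₂ : ℝ) (Q : Tensor d J) (u : Scalar d J) (s : ℝ) : Scalar d J :=
  let g := p.gFactor h Q u s
  let L : Op d J := p.opU h g κ₂
  NormedSpace.exp (-(τ • L)) u
    + τ • phi1 (-(τ • L)) (-(g • p.varU h Q u) + (g * κ₂) • u)

/-- The provisional auxiliary variable `s̃` at the new level `(Q', u')`. -/
def provisionalS (p : Params) (h : ℝ) (Q : Tensor d J) (u : Scalar d J) (s : ℝ)
    (Q' : Tensor d J) (u' : Scalar d J) : ℝ :=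
  s + p.gFactor h Q u s *
    (innerT h (p.varQ h Q u) (Q' - Q) + inner h (p.varU h Q u) (u' - u))

/-- The discrete dissipation rate
`ℛ = (1/τ) (⟨𝒬₁(τℒ) δQ, δQ⟩ + ⟨𝒬₁(τ𝒟) δu, δu⟩)`. -/
def dissipation (p : Params) (h τ κ₁ κ₂ : ℝ) (Q : Tensor d J) (u : Scalar d J) (s : ℝ)
    (Q' : Tensor d J) (u' : Scalar d J) : ℝ :=
  let g := p.gFactor h Q u s
  1 / τ * (innerT h (Op.onTensor (calQ1 (τ • p.opQ h g κ₁)) (Q' - Q)) (Q' - Q)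
    + inner h (calQ1 (τ • p.opU h g κ₂) (u' - u)) (u' - u))

/-- `(Qⁿ, uⁿ, sⁿ)` is generated by the relaxed exponential-integrator scheme from `(Q₀, u₀)`,
with `s⁰ = E_{1h}(Q₀, u₀)` and any admissible choice of the relaxation parameters `ξ`. -/
structure IsNumericalSolution (p : Params) (h η₀ τ κ₁ κ₂ : ℝ) (Q₀ : Tensor d J) (u₀ : Scalar d J)
    (Q : ℕ → Tensor d J) (u : ℕ → Scalar d J) (s : ℕ → ℝ) : Prop where
  init_Q : Q 0 = Q₀
  init_u : u 0 = u₀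
  init_s : s 0 = p.energy1 h Q₀ u₀
  step_Q : ∀ n, Q (n + 1) = p.stepQ h τ κ₁ (Q n) (u n) (s n)
  step_u : ∀ n, u (n + 1) = p.stepU h τ κ₂ (Q n) (u n) (s n)
  step_s : ∀ n, ∃ ξ ∈ Set.Icc (0 : ℝ) 1,
    s (n + 1) = ξ * p.provisionalS h (Q n) (u n) (s n) (Q (n + 1)) (u (n + 1))
      + (1 - ξ) * p.energy1 h (Q (n + 1)) (u (n + 1)) ∧
    s (n + 1) - p.provisionalS h (Q n) (u n) (s n) (Q (n + 1)) (u (n + 1))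
      ≤ η₀ * τ * p.dissipation h τ κ₁ κ₂ (Q n) (u n) (s n) (Q (n + 1)) (u (n + 1))

/-! ### The constants of the maximum bound principle -/

/-- `Ã(x) = A + (2 B₀ q⁴ / s₊²) u(x)²`. -/
def aTilde (p : Params) (u : Scalar d J) (x : Grid d J) : ℝ :=
  p.A + 2 * p.B0 * p.q ^ 4 / p.sPlus d ^ 2 * u x ^ 2

/-- `G` is a lower bound of `g`, `S` an upper bound of `‖forcing‖_∞` and `Amax` an upper bound
of `Ã`, at the state `(Q, u, s)`. -/
structure LevelBounds (p : Params) (h G S Amax : ℝ) (Q : Tensor d J) (u : Scalar d J) (s : ℝ) :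
    Prop where
  le_g : G ≤ p.gFactor h Q u s
  forcing_le : supNorm (p.forcing h u) ≤ S
  aTilde_le : ∀ x, p.aTilde u x ≤ Amax

/-- `b₂ = 0`, `b₃ = |B| / √6`. -/
def bCoeff (p : Params) (d : ℕ) : ℝ := if d = 2 then 0 else |p.B| / √6

/-- `f_d(ξ) = -A ξ + b_d ξ² - C ξ³ + S`. -/
def fPoly (p : Params) (d : ℕ) (S ξ : ℝ) : ℝ :=
  -p.A * ξ + p.bCoeff d * ξ ^ 2 - p.C * ξ ^ 3 + S

/-- `κ₀ = max { Amax + C η², max_{ξ ∈ [0, η]} (A - 2 b_d ξ + 3 C ξ²) }`. -/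
def kappa0 (p : Params) (d : ℕ) (Amax η : ℝ) : ℝ :=
  max (Amax + p.C * η ^ 2)
    (sSup ((fun ξ : ℝ => p.A - 2 * p.bCoeff d * ξ + 3 * p.C * ξ ^ 2) '' Set.Icc 0 η))

end Params

end

end Smectic

open scoped Matrix

set_option linter.unusedSectionVars false

namespace Smectic

noncomputable section

variable {d J : ℕ} [NeZero J]

/-! ### The discrete Laplacian -/

/-! The maximum bound comes from two facts about a single step. With γ = gκ₁, the operator e^{-τℒ}
preserves positivity, and so does φ₁(-τℒ), an average of such exponentials. On constants they act as
multiplication by e^{-τγ} and φ₁(-τγ). Since e^{-z} + zφ₁(-z) = 1, data bounded by η and a source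
bounded by γη give a result bounded by η (`heat_step_le`); testing with the new tensor value turns
this into a Frobenius-norm statement (`frob_heat_step_le`). The source is g(κ₁Q - H). For r = |Q|_F
≤ η its norm is at most g(κ₁r + f_d(r)): κ₀ keeps the coefficient of Q nonnegative and makes r ↦ κ₁r
+ f_d(r) monotone on [0, η], so f_d(η) ≤ 0 bounds it by gκ₁η (`Admissible.frob_stabilized_varQ_le`).

The harder part is to find bounds independent of τ, κ₁, κ₂ and n. In an eigenbasis of Δ_h each step
splits into scalar recursions, for which an exact energy identity holds. If τ ≤ 1, the relaxation
gives back at most η₀τℛ ≤ ℛ, so the quadratic energy plus s decreases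
(`Admissible.modEnergy_step_le`) and s is bounded above by the initial data. The quartic bulk terms
give E_{1h} ≥ ρ³ - β, where ρ is the size of the state, while H and μ grow at most like ρ³; hence
the exponential factor g keeps gH and gμ bounded (`Admissible.exists_weighted_bound`). The
stabilization cancels from the increment of a mode except inside φ₁ ≤ 1, so a step moves the state
by at most τ(const + l · size), whatever κ₁ and κ₂ are. A discrete Gronwall argument then bounds the
state on [0, T]. A lower bound of s follows because sⁿ⁺¹ is a convex combination of s̃ⁿ⁺¹, which is
close to sⁿ, and of E_{1h}, which is bounded below.

If τ ≥ 1, only levels n ≤ T occur, and bounds are carried from level to level without the energy law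
(`Admissible.exists_bound_at_level`). -/

theorem shift_apply (k : Fin d) (r : ZMod J) (U : Scalar d J) (x : Grid d J) :
    shift k r U x = U (x + Pi.single k r) := rfl

theorem shift_dotProduct (k : Fin d) (r : ZMod J) (U V : Scalar d J) :
    shift k r U ⬝ᵥ V = U ⬝ᵥ shift k (-r) V := by
  unfold dotProduct
  rw [← Equiv.sum_comp (Equiv.addRight (Pi.single k r : Grid d J))
    (fun x => U x * shift k (-r) V x)]
  refine Finset.sum_congr rfl fun x _ => ?_
  simp [shift_apply, add_assoc, ← Pi.single_add]

theorem dPlus_dotProduct (h : ℝ) (k : Fin d) (U V : Scalar d J) :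
    dPlus h k U ⬝ᵥ V = -(U ⬝ᵥ dMinus h k V) := by
  simp only [dPlus, dMinus, LinearMap.smul_apply, LinearMap.sub_apply, LinearMap.id_apply,
    smul_dotProduct, dotProduct_smul, sub_dotProduct, dotProduct_sub, shift_dotProduct, smul_eq_mul]
  ring

theorem laplacian_apply (h : ℝ) (U : Scalar d J) :
    laplacian h U = ∑ k : Fin d, dPlus h k (dMinus h k U) := by
  simp [laplacian]

theorem laplacian_dotProduct (h : ℝ) (U V : Scalar d J) :
    laplacian h U ⬝ᵥ V = -∑ k : Fin d, dMinus h k U ⬝ᵥ dMinus h k V := by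
  rw [laplacian_apply, sum_dotProduct, ← Finset.sum_neg_distrib]
  exact Finset.sum_congr rfl fun k _ => dPlus_dotProduct h k _ _

theorem laplacian_dotProduct_comm (h : ℝ) (U V : Scalar d J) :
    laplacian h U ⬝ᵥ V = U ⬝ᵥ laplacian h V := by
  rw [dotProduct_comm U, laplacian_dotProduct, laplacian_dotProduct]
  simp only [dotProduct_comm]

theorem laplacian_dotProduct_self_nonpos (h : ℝ) (U : Scalar d J) :
    laplacian h U ⬝ᵥ U ≤ 0 := by
  rw [laplacian_dotProduct, neg_nonpos]
  exact Finset.sum_nonneg fun k _ => Finset.sum_nonneg fun x _ => mul_self_nonneg _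

/-- An eigenbasis of the discrete Laplacian, orthonormal for the unweighted `ℓ²` product, with
the corresponding eigenvalues of `-Δ_h`. -/
structure LaplaceBasis (h : ℝ) (b : Grid d J → Scalar d J) (ev : Grid d J → ℝ) : Prop where
  orthonormal : ∀ i j, b i ⬝ᵥ b j = if i = j then 1 else 0
  expand : ∀ U : Scalar d J, U = ∑ i, (b i ⬝ᵥ U) • b i
  eigen : ∀ i, laplacian h (b i) = (-ev i) • b i
  nonneg : ∀ i, 0 ≤ ev i

/-- Summation by parts makes Δ_h symmetric and nonpositive, so the spectral theorem on
`EuclideanSpace` applies; `e` only forgets the ℓ² structure. -/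
theorem exists_laplaceBasis (h : ℝ) :
    ∃ (b : Grid d J → Scalar d J) (ev : Grid d J → ℝ), LaplaceBasis h b ev := by
  classical
  let e := WithLp.linearEquiv 2 ℝ (Scalar d J)
  let T : EuclideanSpace ℝ (Grid d J) →ₗ[ℝ] EuclideanSpace ℝ (Grid d J) :=
    e.symm.toLinearMap ∘ₗ (laplacian h : Scalar d J →L[ℝ] Scalar d J).toLinearMap ∘ₗ e.toLinearMap
  have hin : ∀ x y : EuclideanSpace ℝ (Grid d J), Inner.inner ℝ x y = e x ⬝ᵥ e y := by
    intro x y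
    simp [PiLp.inner_apply, dotProduct, e, mul_comm]
  have hT : T.IsSymmetric := by
    intro x y
    rw [hin, hin]
    exact laplacian_dotProduct_comm h _ _
  have hn : Module.finrank ℝ (EuclideanSpace ℝ (Grid d J)) = Fintype.card (Grid d J) :=
    finrank_euclideanSpace
  let B := (hT.eigenvectorBasis hn).reindex (Fintype.equivFin (Grid d J)).symm
  have hB : ∀ i, ∃ l : ℝ, T (B i) = l • B i := by
    intro i
    refine ⟨hT.eigenvalues hn (Fintype.equivFin (Grid d J) i), ?_⟩
    simp only [B, OrthonormalBasis.reindex_apply, Equiv.symm_symm]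
    exact hT.apply_eigenvectorBasis hn _
  choose l hl using hB
  have hon : ∀ i j, e (B i) ⬝ᵥ e (B j) = if i = j then 1 else 0 := by
    intro i j
    rw [← hin]
    exact orthonormal_iff_ite.mp B.orthonormal i j
  have heig : ∀ i, laplacian h (e (B i)) = l i • e (B i) := by
    intro i
    have := congrArg e (hl i)
    simpa [T] using this
  refine ⟨fun i => e (B i), fun i => -l i, hon, ?_, ?_, ?_⟩
  · intro U
    have := congrArg e (B.sum_repr' (e.symm U))
    simp only [map_sum, map_smul, hin, LinearEquiv.apply_symm_apply] at this
    exact this.symm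
  · intro i
    simpa using heig i
  · intro i
    have := laplacian_dotProduct_self_nonpos h (e (B i))
    rw [heig, smul_dotProduct, hon] at this
    simpa using this

/-! ### Operators that are diagonal in an eigenbasis -/

/-- Exponentials act on eigenvectors by exponentials. -/
theorem exp_apply_of_eigen {Z : Op d J} {v : Scalar d J} {z : ℝ} (hv : Z v = z • v) :
    NormedSpace.exp Z v = Real.exp z • v := by
  have hpow : ∀ n : ℕ, (Z ^ n) v = z ^ n • v := by
    intro n
    induction n with
    | zero => simp
    | succ n ih => rw [pow_succ, mul_apply_eq_comp, hv, map_smul, ih, smul_smul, pow_succ,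
        mul_comm]
  have h1 := NormedSpace.exp_series_hasSum_exp' (𝕂 := ℝ) Z
  have h2 := (ContinuousLinearMap.apply ℝ (Scalar d J) v).hasSum h1
  have h3 := (NormedSpace.exp_series_hasSum_exp' (𝕂 := ℝ) z).smul_const v
  rw [← Real.exp_eq_exp_ℝ] at h3
  refine h2.unique ?_
  convert! h3 using 2 with n
  simp [hpow, smul_smul]

theorem inverse_apply_of_eigen {Z : Op d J} (hZ : IsUnit Z) {v : Scalar d J} {z : ℝ} (hz : z ≠ 0)
    (hv : Z v = z • v) : Ring.inverse Z v = z⁻¹ • v := by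
  have h1 : v = z⁻¹ • Z v := by rw [hv, smul_smul, inv_mul_cancel₀ hz, one_smul]
  conv_lhs => rw [h1]
  rw [map_smul, ← mul_apply_eq_comp, Ring.inverse_mul_cancel _ hZ,
    one_apply_eq_self]

namespace LaplaceBasis

variable {h : ℝ} {b : Grid d J → Scalar d J} {ev : Grid d J → ℝ}

theorem apply_eq_sum (hb : LaplaceBasis h b ev) {T : Op d J} {f : Grid d J → ℝ}
    (hT : ∀ i, T (b i) = f i • b i) (U : Scalar d J) :
    T U = ∑ i, (f i * (b i ⬝ᵥ U)) • b i := by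
  conv_lhs => rw [hb.expand U]
  simp only [map_sum, map_smul, hT, smul_smul]
  exact Finset.sum_congr rfl fun i _ => by rw [mul_comm]

theorem dotProduct_sum (hb : LaplaceBasis h b ev) (c : Grid d J → ℝ) (i : Grid d J) :
    b i ⬝ᵥ (∑ j, c j • b j) = c i := by
  simp [_root_.dotProduct_sum, dotProduct_smul, hb.orthonormal]

theorem dotProduct_apply (hb : LaplaceBasis h b ev) {T : Op d J} {f : Grid d J → ℝ}
    (hT : ∀ i, T (b i) = f i • b i) (U : Scalar d J) (i : Grid d J) :
    b i ⬝ᵥ T U = f i * (b i ⬝ᵥ U) := by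
  rw [hb.apply_eq_sum hT, hb.dotProduct_sum]

theorem dotProduct_eq_sum (hb : LaplaceBasis h b ev) (U V : Scalar d J) :
    U ⬝ᵥ V = ∑ i, (b i ⬝ᵥ U) * (b i ⬝ᵥ V) := by
  conv_lhs => rw [hb.expand U]
  simp [sum_dotProduct, smul_dotProduct]

theorem isUnit (hb : LaplaceBasis h b ev) {T : Op d J} {f : Grid d J → ℝ}
    (hT : ∀ i, T (b i) = f i • b i) (hf : ∀ i, f i ≠ 0) : IsUnit T := by
  let S : Op d J := LinearMap.toContinuousLinearMap
    (∑ i, (LinearMap.toSpanSingleton ℝ (Scalar d J) (b i)) ∘ₗ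
      ((f i)⁻¹ • dotProductBilin ℝ ℝ (b i)))
  have hS : ∀ U, S U = ∑ i, ((f i)⁻¹ * (b i ⬝ᵥ U)) • b i := by
    intro U; simp [S, LinearMap.toSpanSingleton_apply]
  refine ⟨⟨T, S, ?_, ?_⟩, rfl⟩
  · ext1 U
    rw [mul_apply_eq_comp, hb.apply_eq_sum hT, hS]
    simp only [hb.dotProduct_sum, mul_inv_cancel_left₀ (hf _)]
    exact (hb.expand U).symm
  · ext1 U
    rw [mul_apply_eq_comp, hS, hb.apply_eq_sum hT]
    simp only [hb.dotProduct_sum, inv_mul_cancel_left₀ (hf _)]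
    exact (hb.expand U).symm

theorem phi1_apply (hb : LaplaceBasis h b ev) {T : Op d J} {f : Grid d J → ℝ}
    (hT : ∀ i, T (b i) = f i • b i) (hf : ∀ i, f i ≠ 0) (i : Grid d J) :
    phi1 T (b i) = ((f i)⁻¹ * (Real.exp (f i) - 1)) • b i := by
  rw [phi1, mul_apply_eq_comp, sub_apply,
    exp_apply_of_eigen (hT i), one_apply_eq_self]
  nth_rw 2 [← one_smul ℝ (b i)]
  rw [← sub_smul, map_smul, inverse_apply_of_eigen (hb.isUnit hT hf) (hf i) (hT i), smul_smul,
    mul_comm]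

theorem calQ1_apply (hb : LaplaceBasis h b ev) {T : Op d J} {f : Grid d J → ℝ}
    (hT : ∀ i, T (b i) = f i • b i) (hf : ∀ i, f i ≠ 0) (i : Grid d J) :
    calQ1 T (b i) = (f i / (Real.exp (f i) - 1) + f i / 2) • b i := by
  have hE : ∀ j, (NormedSpace.exp T - 1) (b j) = (Real.exp (f j) - 1) • b j := by
    intro j
    rw [sub_apply, exp_apply_of_eigen (hT j), one_apply_eq_self,
      sub_smul, one_smul]
  have hE0 : ∀ j, Real.exp (f j) - 1 ≠ 0 := fun j =>
    sub_ne_zero.mpr fun hc => hf j (by simpa using hc)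
  rw [calQ1, calQ, add_apply, mul_apply_eq_comp,
    inverse_apply_of_eigen (hb.isUnit hE hE0) (hE0 i) (hE i), map_smul, hT, smul_smul,
    smul_apply, hT, smul_smul, ← add_smul]
  congr 1
  ring

end LaplaceBasis

/-! ### One step of the exponential integrator -/

theorem phi1_factor_pos {z : ℝ} (hz : 0 < z) : 0 < (-z)⁻¹ * (Real.exp (-z) - 1) := by
  have h1 : Real.exp (-z) < 1 := by simpa using hz
  have h2 : (-z)⁻¹ < 0 := inv_lt_zero.mpr (by linarith)
  exact mul_pos_of_neg_of_neg h2 (by linarith)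

theorem phi1_factor_le_one {z : ℝ} (hz : 0 < z) : (-z)⁻¹ * (Real.exp (-z) - 1) ≤ 1 := by
  have := Real.add_one_le_exp (-z)
  rw [inv_neg, neg_mul, ← mul_neg, inv_mul_le_iff₀ hz]
  linarith

theorem exp_neg_eq_phi1_factor {z : ℝ} (hz : 0 < z) :
    Real.exp (-z) = 1 - z * ((-z)⁻¹ * (Real.exp (-z) - 1)) := by
  have := hz.ne'
  field_simp
  ring

theorem div_exp_sub_one_eq_phi1_factor {z : ℝ} (hz : 0 < z) :
    z / (Real.exp z - 1) = ((-z)⁻¹ * (Real.exp (-z) - 1))⁻¹ - z := by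
  have hE1 : 1 < Real.exp z := Real.one_lt_exp_iff.mpr hz
  have hE : Real.exp z - 1 ≠ 0 := by linarith
  have h0 := hz.ne'
  have h2 : (-z)⁻¹ * ((Real.exp z)⁻¹ - 1) = (Real.exp z - 1) / (z * Real.exp z) := by
    field_simp
    ring
  rw [Real.exp_neg, h2]
  field_simp
  ring

/-- Here `l` is the eigenvalue of the unstabilized operator and `γ` the stabilization. Writing
e^{-z} = 1 - zφ with z = τ(l + γ), the two contributions of γc cancel, and γ survives only inside φ.
-/
theorem mode_increment_eq {τ l γ c f c' : ℝ} (hτ : 0 < τ) (hl : 0 < l + γ)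
    (hc' : c' = Real.exp (-(τ * (l + γ))) * c
      + τ * ((-(τ * (l + γ)))⁻¹ * (Real.exp (-(τ * (l + γ))) - 1) * (-f + γ * c))) :
    c' - c = -(τ * ((-(τ * (l + γ)))⁻¹ * (Real.exp (-(τ * (l + γ))) - 1)) * (f + l * c)) := by
  have hE := exp_neg_eq_phi1_factor (mul_pos hτ hl)
  set φ := (-(τ * (l + γ)))⁻¹ * (Real.exp (-(τ * (l + γ))) - 1)
  rw [hc', hE]
  ring

/-- The energy identity of one exponential step, in a single mode. -/
theorem mode_energy_identity {τ l γ c f c' : ℝ} (hτ : 0 < τ) (hl : 0 < l + γ)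
    (hc' : c' = Real.exp (-(τ * (l + γ))) * c
      + τ * ((-(τ * (l + γ)))⁻¹ * (Real.exp (-(τ * (l + γ))) - 1) * (-f + γ * c))) :
    f * (c' - c) + 1 / 2 * (l * c' * c') - 1 / 2 * (l * c * c)
      + 1 / τ * ((τ * (l + γ) / (Real.exp (τ * (l + γ)) - 1) + τ * (l + γ) / 2) * (c' - c) * (c' - c))
      = -(γ / 2 * ((c' - c) * (c' - c))) := by
  have hd := mode_increment_eq hτ hl hc'
  have hφ := phi1_factor_pos (mul_pos hτ hl)
  rw [div_exp_sub_one_eq_phi1_factor (mul_pos hτ hl)]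
  set φ := (-(τ * (l + γ)))⁻¹ * (Real.exp (-(τ * (l + γ))) - 1)
  obtain ⟨δ, rfl⟩ : ∃ δ, c' = c + δ := ⟨c' - c, by ring⟩
  have hd' : δ = -(τ * φ * (f + l * c)) := by linarith
  -- Solving the increment formula for f leaves a polynomial identity in c and δ: with z/(e^z - 1) =
  -- 1/φ - z the terms in 1/φ cancel, and lδ²/2 - (l + γ)δ²/2 remains.
  have hf : f = -l * c - δ / (τ * φ) := by
    have := (mul_pos hτ hφ).ne'
    rw [hd']
    field_simp
    ring
  have hτ' := hτ.ne'
  have hφ' := hφ.ne'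
  rw [hf]
  field_simp
  ring

/-- Since 0 < φ ≤ 1, the bound is free of γ; this is why the later constants do not depend on κ₁ and
κ₂. -/
theorem mode_increment_sq_le {τ l γ c f c' : ℝ} (hτ : 0 < τ) (hl : 0 < l + γ)
    (hc' : c' = Real.exp (-(τ * (l + γ))) * c
      + τ * ((-(τ * (l + γ)))⁻¹ * (Real.exp (-(τ * (l + γ))) - 1) * (-f + γ * c))) :
    (c' - c) * (c' - c) ≤ τ ^ 2 * ((f + l * c) * (f + l * c)) := by
  have hd := mode_increment_eq hτ hl hc'
  have h0 := (phi1_factor_pos (mul_pos hτ hl)).le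
  have h1 := phi1_factor_le_one (mul_pos hτ hl)
  set φ := (-(τ * (l + γ)))⁻¹ * (Real.exp (-(τ * (l + γ))) - 1)
  have h2 : φ * φ ≤ 1 := mul_le_one₀ h1 h0 h1
  rw [hd]
  have h3 := mul_le_of_le_one_right (mul_nonneg (sq_nonneg τ) (mul_self_nonneg (f + l * c))) h2
  linarith

/-- The unweighted `ℓ²` norm of a grid function. -/
def l2 (U : Scalar d J) : ℝ := ‖(WithLp.toLp 2 U : EuclideanSpace ℝ (Grid d J))‖

theorem l2_nonneg (U : Scalar d J) : 0 ≤ l2 U := norm_nonneg _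

theorem l2_sq (U : Scalar d J) : l2 U ^ 2 = U ⬝ᵥ U := by
  rw [l2, EuclideanSpace.norm_sq_eq]
  simp [dotProduct, sq]

theorem l2_add_le (U V : Scalar d J) : l2 (U + V) ≤ l2 U + l2 V := norm_add_le _ _

theorem abs_dotProduct_le (U V : Scalar d J) : |U ⬝ᵥ V| ≤ l2 U * l2 V := by
  refine abs_le_of_sq_le_sq ?_ (mul_nonneg (l2_nonneg _) (l2_nonneg _))
  rw [mul_pow, l2_sq, l2_sq]
  simpa [dotProduct, sq] using Finset.sum_mul_sq_le_sq_mul_sq Finset.univ U V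

theorem abs_apply_le_l2 (U : Scalar d J) (x : Grid d J) : |U x| ≤ l2 U := by
  simpa [l2] using PiLp.norm_apply_le (WithLp.toLp 2 U : EuclideanSpace ℝ (Grid d J)) x

theorem l2_le_of_abs_le {U : Scalar d J} {m : ℝ} (hU : ∀ x, |U x| ≤ m) :
    l2 U ≤ √(Fintype.card (Grid d J)) * m := by
  have hm : 0 ≤ m := (abs_nonneg _).trans (hU 0)
  refine abs_le_of_sq_le_sq' ?_ (by positivity) |>.2
  rw [l2_sq, mul_pow, Real.sq_sqrt (by positivity)]
  calc U ⬝ᵥ U ≤ ∑ _x : Grid d J, m ^ 2 := by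
        refine Finset.sum_le_sum fun x _ => ?_
        rw [← sq, ← sq_abs]
        exact pow_le_pow_left₀ (abs_nonneg _) (hU x) 2
    _ = _ := by simp

/-! ### Energy inequality and increment bound of one step, summed over the modes. -/

namespace LaplaceBasis

variable {h : ℝ} {b : Grid d J → Scalar d J} {ev : Grid d J → ℝ}
  {Λ : Op d J} {l : Grid d J → ℝ} {γ τ : ℝ} {U U' F : Scalar d J}

theorem smul_shifted_apply (hΛ : ∀ i, Λ (b i) = l i • b i) (r : ℝ) (i : Grid d J) :
    (r • (Λ + γ • (1 : Op d J))) (b i) = (r * (l i + γ)) • b i := by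
  simp only [smul_apply, add_apply, hΛ, one_apply_eq_self]
  rw [← add_smul, smul_smul]

theorem mode_step (hb : LaplaceBasis h b ev) (hΛ : ∀ i, Λ (b i) = l i • b i)
    (hl : ∀ i, 0 ≤ l i) (hγ : 0 < γ) (hτ : 0 < τ)
    (hU : U' = NormedSpace.exp (-(τ • (Λ + γ • (1 : Op d J)))) U
      + τ • phi1 (-(τ • (Λ + γ • (1 : Op d J)))) (-F + γ • U)) (i : Grid d J) :
    b i ⬝ᵥ U' = Real.exp (-(τ * (l i + γ))) * (b i ⬝ᵥ U)
      + τ * ((-(τ * (l i + γ)))⁻¹ * (Real.exp (-(τ * (l i + γ))) - 1)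
        * (-(b i ⬝ᵥ F) + γ * (b i ⬝ᵥ U))) := by
  have hZ : ∀ i, (-(τ • (Λ + γ • (1 : Op d J)))) (b i) = (-(τ * (l i + γ))) • b i := by
    intro i
    rw [neg_apply, smul_shifted_apply hΛ, neg_smul]
  have hZ0 : ∀ i, -(τ * (l i + γ)) ≠ 0 := fun i =>
    neg_ne_zero.mpr (mul_pos hτ (by linarith [hl i])).ne'
  rw [hU, dotProduct_add, hb.dotProduct_apply (fun i => exp_apply_of_eigen (hZ i)),
    dotProduct_smul, hb.dotProduct_apply (hb.phi1_apply hZ hZ0), dotProduct_add, dotProduct_neg,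
    dotProduct_smul]
  simp only [smul_eq_mul]

theorem calQ1_dotProduct_eq (hb : LaplaceBasis h b ev) (hΛ : ∀ i, Λ (b i) = l i • b i)
    (hl : ∀ i, 0 ≤ l i) (hγ : 0 < γ) (hτ : 0 < τ) (V : Scalar d J) :
    calQ1 (τ • (Λ + γ • (1 : Op d J))) V ⬝ᵥ V =
      ∑ i, (τ * (l i + γ) / (Real.exp (τ * (l i + γ)) - 1) + τ * (l i + γ) / 2)
        * (b i ⬝ᵥ V) * (b i ⬝ᵥ V) := by
  have hZ0 : ∀ i, τ * (l i + γ) ≠ 0 := fun i => (mul_pos hτ (by linarith [hl i])).ne'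
  rw [hb.dotProduct_eq_sum]
  refine Finset.sum_congr rfl fun i _ => ?_
  rw [hb.dotProduct_apply (hb.calQ1_apply (smul_shifted_apply hΛ τ) hZ0)]

theorem calQ1_dotProduct_nonneg (hb : LaplaceBasis h b ev) (hΛ : ∀ i, Λ (b i) = l i • b i)
    (hl : ∀ i, 0 ≤ l i) (hγ : 0 < γ) (hτ : 0 < τ) (V : Scalar d J) :
    0 ≤ calQ1 (τ • (Λ + γ • (1 : Op d J))) V ⬝ᵥ V := by
  rw [hb.calQ1_dotProduct_eq hΛ hl hγ hτ]
  refine Finset.sum_nonneg fun i _ => ?_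
  have hz : 0 < τ * (l i + γ) := mul_pos hτ (by linarith [hl i])
  have hE : 0 < Real.exp (τ * (l i + γ)) - 1 := by linarith [Real.one_lt_exp_iff.mpr hz]
  rw [mul_assoc]
  exact mul_nonneg (by positivity) (mul_self_nonneg _)

/-- Parseval and the single-mode identity give the exact value -γ/2 |U' - U|² of the left-hand side;
only its sign is kept. -/
theorem step_energy_le (hb : LaplaceBasis h b ev) (hΛ : ∀ i, Λ (b i) = l i • b i)
    (hl : ∀ i, 0 ≤ l i) (hγ : 0 < γ) (hτ : 0 < τ)
    (hU : U' = NormedSpace.exp (-(τ • (Λ + γ • (1 : Op d J)))) U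
      + τ • phi1 (-(τ • (Λ + γ • (1 : Op d J)))) (-F + γ • U)) :
    F ⬝ᵥ (U' - U) + 1 / 2 * (Λ U' ⬝ᵥ U') - 1 / 2 * (Λ U ⬝ᵥ U)
      + 1 / τ * (calQ1 (τ • (Λ + γ • (1 : Op d J))) (U' - U) ⬝ᵥ (U' - U)) ≤ 0 := by
  rw [hb.calQ1_dotProduct_eq hΛ hl hγ hτ, hb.dotProduct_eq_sum F, hb.dotProduct_eq_sum (Λ U'),
    hb.dotProduct_eq_sum (Λ U), Finset.mul_sum, Finset.mul_sum, Finset.mul_sum,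
    ← Finset.sum_add_distrib, ← Finset.sum_sub_distrib, ← Finset.sum_add_distrib]
  refine Finset.sum_nonpos fun i _ => ?_
  have := mode_energy_identity hτ (by linarith [hl i]) (hb.mode_step hΛ hl hγ hτ hU i)
  rw [hb.dotProduct_apply hΛ, hb.dotProduct_apply hΛ, dotProduct_sub, this, neg_nonpos]
  exact mul_nonneg (by linarith) (mul_self_nonneg _)

theorem l2_apply_le (hb : LaplaceBasis h b ev) (hΛ : ∀ i, Λ (b i) = l i • b i)
    (hl : ∀ i, 0 ≤ l i) {lmax : ℝ} (hmax : ∀ i, l i ≤ lmax) (U : Scalar d J) :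
    l2 (Λ U) ≤ lmax * l2 U := by
  have h0 : 0 ≤ lmax := (hl 0).trans (hmax 0)
  refine abs_le_of_sq_le_sq' ?_ (mul_nonneg h0 (l2_nonneg _)) |>.2
  rw [l2_sq, mul_pow, l2_sq, hb.dotProduct_eq_sum, hb.dotProduct_eq_sum U, Finset.mul_sum]
  refine Finset.sum_le_sum fun i _ => ?_
  rw [hb.dotProduct_apply hΛ]
  have : l i ^ 2 ≤ lmax ^ 2 := pow_le_pow_left₀ (hl i) (hmax i) 2
  have := mul_le_mul_of_nonneg_right this (mul_self_nonneg (b i ⬝ᵥ U))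
  linarith

theorem step_increment_le (hb : LaplaceBasis h b ev) (hΛ : ∀ i, Λ (b i) = l i • b i)
    (hl : ∀ i, 0 ≤ l i) {lmax : ℝ} (hmax : ∀ i, l i ≤ lmax) (hγ : 0 < γ) (hτ : 0 < τ)
    (hU : U' = NormedSpace.exp (-(τ • (Λ + γ • (1 : Op d J)))) U
      + τ • phi1 (-(τ • (Λ + γ • (1 : Op d J)))) (-F + γ • U)) :
    l2 (U' - U) ≤ τ * (l2 F + lmax * l2 U) := by
  have h1 : l2 (U' - U) ≤ τ * l2 (F + Λ U) := by
    refine abs_le_of_sq_le_sq' ?_ (mul_nonneg hτ.le (l2_nonneg _)) |>.2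
    rw [l2_sq, mul_pow, l2_sq, hb.dotProduct_eq_sum, hb.dotProduct_eq_sum (F + Λ U),
      Finset.mul_sum]
    refine Finset.sum_le_sum fun i _ => ?_
    rw [dotProduct_sub, dotProduct_add, hb.dotProduct_apply hΛ]
    exact mode_increment_sq_le hτ (by linarith [hl i]) (hb.mode_step hΛ hl hγ hτ hU i)
  refine h1.trans (mul_le_mul_of_nonneg_left ?_ hτ.le)
  exact (l2_add_le _ _).trans (by linarith [hb.l2_apply_le hΛ hl hmax U])

end LaplaceBasis

/-! ### Positivity of the heat semigroup and the scalar maximum principle -/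

theorem laplacian_apply_apply (h : ℝ) (U : Scalar d J) (x : Grid d J) :
    laplacian h U x = ∑ k : Fin d,
      h⁻¹ * h⁻¹ * (U (x + Pi.single k 1) + U (x + Pi.single k (-1)) - 2 * U x) := by
  rw [laplacian_apply, Finset.sum_apply]
  refine Finset.sum_congr rfl fun k _ => ?_
  simp only [dPlus, dMinus, LinearMap.smul_apply, LinearMap.sub_apply, LinearMap.id_apply,
    Pi.smul_apply, Pi.sub_apply, shift_apply, smul_eq_mul, add_assoc, ← Pi.single_add]
  simp
  ring

theorem laplacian_const (h m : ℝ) : laplacian h (fun _ => m : Scalar d J) = 0 := by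
  ext x
  rw [laplacian_apply_apply]
  refine Finset.sum_eq_zero fun k _ => ?_
  ring

/-- Every term of the exponential series is a nonnegative multiple of a positivity-preserving power.
-/
theorem exp_apply_nonneg {Y : Op d J} (hY : ∀ U, 0 ≤ U → 0 ≤ Y U) {U : Scalar d J} (hU : 0 ≤ U) :
    0 ≤ NormedSpace.exp Y U := by
  have hpow : ∀ n : ℕ, 0 ≤ (Y ^ n) U := by
    intro n
    induction n with
    | zero => simpa using hU
    | succ n ih => rw [pow_succ', mul_apply_eq_comp]; exact hY _ ih
  have h1 := NormedSpace.exp_series_hasSum_exp' (𝕂 := ℝ) Y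
  intro x
  have h2 := ((ContinuousLinearMap.proj (R := ℝ) (φ := fun _ : Grid d J => ℝ) x).comp
    (ContinuousLinearMap.apply ℝ (Scalar d J) U)).hasSum h1
  refine h2.nonneg fun n => ?_
  have := hpow n x
  simp only [ContinuousLinearMap.comp_apply, ContinuousLinearMap.apply_apply, smul_apply,
    ContinuousLinearMap.proj_apply, Pi.smul_apply, smul_eq_mul]
  exact mul_nonneg (by positivity) this

theorem exp_heat_nonneg (h : ℝ) {K γ t : ℝ} (hK : 0 ≤ K) (ht : 0 ≤ t) {U : Scalar d J}
    (hU : 0 ≤ U) :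
    0 ≤ (NormedSpace.exp (-(t • (-(K • laplacian h) + γ • (1 : Op d J)))) : Op d J) U := by
  let _ := NormedAlgebra.restrictScalars ℚ ℝ (Op d J)
  set Z : Op d J := -(t • (-(K • laplacian h) + γ • (1 : Op d J))) with hZ
  -- The shift by m removes γ and the negative term -2U(x) of the Laplacian, leaving only
  -- nonnegative neighbour weights. As multiples of the identity commute with everything, e^Z is
  -- e^{-m} times the exponential of this shifted operator.
  set m : ℝ := t * (γ + K * ∑ _k : Fin d, h⁻¹ * h⁻¹ * 2) with hm
  have hY : ∀ V : Scalar d J, 0 ≤ V → 0 ≤ (Z + m • (1 : Op d J)) V := by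
    intro V hV x
    have : (Z + m • (1 : Op d J)) V x =
        t * K * ∑ k : Fin d, h⁻¹ * h⁻¹ * (V (x + Pi.single k 1) + V (x + Pi.single k (-1))) := by
      simp only [hZ, hm, add_apply, neg_apply, smul_apply, one_apply_eq_self, Pi.add_apply,
        Pi.neg_apply, Pi.smul_apply, smul_eq_mul, laplacian_apply_apply, mul_sub, mul_add,
        Finset.sum_sub_distrib, Finset.sum_add_distrib, ← Finset.mul_sum]
      simp
      ring
    rw [this]
    refine mul_nonneg (mul_nonneg ht hK) (Finset.sum_nonneg fun k _ => ?_)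
    exact mul_nonneg (mul_self_nonneg _) (add_nonneg (hV _) (hV _))
  have hsplit : Z = (Z + m • (1 : Op d J)) + (-m) • (1 : Op d J) := by
    module
  have hcomm : Commute (Z + m • (1 : Op d J)) ((-m) • (1 : Op d J)) :=
    (Commute.one_right _).smul_right _
  rw [hsplit, NormedSpace.exp_add_of_commute hcomm, mul_apply_eq_comp,
    exp_apply_of_eigen (Z := (-m) • (1 : Op d J)) (z := -m) (by simp), map_smul]
  exact smul_nonneg (Real.exp_pos _).le (exp_apply_nonneg hY hU)

/-- Integrating d/dσ e^{σZ} = Z e^{σZ} over [0, 1] and cancelling Z. In this form φ₁ inherits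
positivity from the exponentials. -/
theorem phi1_eq_integral {Z : Op d J} (hZ : IsUnit Z) :
    phi1 Z = ∫ σ in (0 : ℝ)..1, NormedSpace.exp (σ • Z) := by
  let _ := NormedAlgebra.restrictScalars ℚ ℝ (Op d J)
  have hcont : Continuous fun σ : ℝ => NormedSpace.exp (σ • Z) :=
    NormedSpace.exp_continuous.comp (continuous_id.smul continuous_const)
  have h1 : ∫ σ in (0 : ℝ)..1, Z * NormedSpace.exp (σ • Z) = NormedSpace.exp Z - 1 := by
    rw [intervalIntegral.integral_eq_sub_of_hasDerivAt
      (f := fun σ : ℝ => NormedSpace.exp (σ • Z)) (fun σ _ => hasDerivAt_exp_smul_const' Z σ)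
      ((continuous_const.mul hcont).intervalIntegrable _ _)]
    simp
  have h2 : ∫ σ in (0 : ℝ)..1, Z * NormedSpace.exp (σ • Z) =
      Z * ∫ σ in (0 : ℝ)..1, NormedSpace.exp (σ • Z) :=
    (ContinuousLinearMap.mul ℝ (Op d J) Z).intervalIntegral_comp_comm
      (hcont.intervalIntegrable _ _)
  rw [phi1, ← h1, h2, ← mul_assoc, Ring.inverse_mul_cancel _ hZ, one_mul]

theorem phi1_apply_nonneg {Z : Op d J} (hZ : IsUnit Z)
    (hpos : ∀ σ : ℝ, 0 ≤ σ → ∀ U, 0 ≤ U → 0 ≤ NormedSpace.exp (σ • Z) U)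
    {U : Scalar d J} (hU : 0 ≤ U) : 0 ≤ phi1 Z U := by
  let _ := NormedAlgebra.restrictScalars ℚ ℝ (Op d J)
  have hcont : Continuous fun σ : ℝ => NormedSpace.exp (σ • Z) :=
    NormedSpace.exp_continuous.comp (continuous_id.smul continuous_const)
  intro x
  have h2 := ((ContinuousLinearMap.proj (R := ℝ) (φ := fun _ : Grid d J => ℝ) x).comp
    (ContinuousLinearMap.apply ℝ (Scalar d J) U)).intervalIntegral_comp_comm
    (hcont.intervalIntegrable (μ := MeasureTheory.volume) 0 1)
  rw [← phi1_eq_integral hZ] at h2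
  have h3 : phi1 Z U x = ∫ σ in (0 : ℝ)..1, NormedSpace.exp (σ • Z) U x := h2.symm
  rw [h3]
  exact intervalIntegral.integral_nonneg zero_le_one fun σ hσ => hpos σ hσ.1 U hU x

theorem isUnit_heat (h : ℝ) {K γ τ : ℝ} (hK : 0 ≤ K) (hγ : 0 < γ) (hτ : 0 < τ) :
    IsUnit (-(τ • (-(K • laplacian h) + γ • (1 : Op d J)))) := by
  obtain ⟨b, ev, hb⟩ := exists_laplaceBasis (d := d) (J := J) h
  have hΛ : ∀ i, (-(K • laplacian h) : Op d J) (b i) = (K * ev i) • b i := by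
    intro i
    rw [neg_apply, smul_apply, hb.eigen, smul_smul, ← neg_smul]
    congr 1
    ring
  refine (hb.isUnit (LaplaceBasis.smul_shifted_apply hΛ τ) fun i => ?_).neg
  exact (mul_pos hτ (by linarith [mul_nonneg hK (hb.nonneg i)])).ne'

/-- Comparison with the constant state m under the constant source γm, which the step reproduces
exactly because e^{-τγ} + τγφ₁(-τγ) = 1; positivity orders the two results. -/
theorem heat_step_le (h : ℝ) {K γ τ m : ℝ} (hK : 0 ≤ K) (hγ : 0 < γ) (hτ : 0 < τ)
    {U N : Scalar d J} (hU : ∀ x, U x ≤ m) (hN : ∀ x, N x ≤ γ * m) (x : Grid d J) :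
    (NormedSpace.exp (-(τ • (-(K • laplacian h) + γ • (1 : Op d J)))) : Op d J) U x
      + τ * phi1 (-(τ • (-(K • laplacian h) + γ • (1 : Op d J)))) N x ≤ m := by
  have hunit := isUnit_heat (d := d) (J := J) h hK hγ hτ
  set Z : Op d J := -(τ • (-(K • laplacian h) + γ • (1 : Op d J))) with hZ
  let one : Scalar d J := fun _ => 1
  have hone : Z one = (-(τ * γ)) • one := by
    have := laplacian_const (d := d) (J := J) h 1
    simp only [hZ, neg_apply, smul_apply, add_apply, one_apply_eq_self, one, this]
    simp [smul_smul]
  have hz0 : 0 < τ * γ := mul_pos hτ hγ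
  have h1 : 0 ≤ NormedSpace.exp Z (m • one - U) := by
    refine exp_heat_nonneg h hK hτ.le fun y => ?_
    simpa [one] using hU y
  have h2 : 0 ≤ phi1 Z ((γ * m) • one - N) := by
    refine phi1_apply_nonneg hunit (fun σ hσ V hV => ?_) fun y => by simpa [one] using hN y
    rw [hZ, smul_neg, smul_smul]
    exact exp_heat_nonneg h hK (mul_nonneg hσ hτ.le) hV
  have e1 : NormedSpace.exp Z one = Real.exp (-(τ * γ)) • one := exp_apply_of_eigen hone
  have e2 : phi1 Z one = ((-(τ * γ))⁻¹ * (Real.exp (-(τ * γ)) - 1)) • one := by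
    rw [phi1, mul_apply_eq_comp, sub_apply, e1, one_apply_eq_self]
    nth_rw 2 [← one_smul ℝ one]
    rw [← sub_smul, map_smul, inverse_apply_of_eigen hunit (neg_ne_zero.mpr hz0.ne') hone,
      smul_smul, mul_comm]
  have h1x := h1 x
  have h2x := h2 x
  rw [map_sub, map_smul, e1] at h1x
  rw [map_sub, map_smul, e2] at h2x
  simp only [Pi.zero_apply, Pi.sub_apply, Pi.smul_apply, smul_eq_mul, one, mul_one] at h1x h2x
  have hE := exp_neg_eq_phi1_factor hz0
  set φ := (-(τ * γ))⁻¹ * (Real.exp (-(τ * γ)) - 1)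
  rw [hE] at h1x
  have h3 := mul_nonneg hτ.le h2x
  linarith

/-! ### The Frobenius norm -/

theorem frob_eq_norm (M : Matrix (Fin d) (Fin d) ℝ) :
    frob M = ‖(WithLp.toLp 2 fun p : Fin d × Fin d => M p.1 p.2 :
      EuclideanSpace ℝ (Fin d × Fin d))‖ := by
  rw [frob, EuclideanSpace.norm_eq]
  simp [Fintype.sum_prod_type]

theorem frob_nonneg (M : Matrix (Fin d) (Fin d) ℝ) : 0 ≤ frob M := Real.sqrt_nonneg _

theorem frob_sq (M : Matrix (Fin d) (Fin d) ℝ) : frob M ^ 2 = ∑ i, ∑ j, M i j ^ 2 :=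
  Real.sq_sqrt (Finset.sum_nonneg fun _ _ => Finset.sum_nonneg fun _ _ => sq_nonneg _)

theorem frob_add_le (M M' : Matrix (Fin d) (Fin d) ℝ) : frob (M + M') ≤ frob M + frob M' := by
  simp only [frob_eq_norm]
  exact norm_add_le (WithLp.toLp 2 fun p : Fin d × Fin d => M p.1 p.2 :
    EuclideanSpace ℝ (Fin d × Fin d))
    (WithLp.toLp 2 fun p : Fin d × Fin d => M' p.1 p.2 :
    EuclideanSpace ℝ (Fin d × Fin d))

theorem frob_neg (M : Matrix (Fin d) (Fin d) ℝ) : frob (-M) = frob M := by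
  simp [frob]

theorem frob_smul (r : ℝ) (M : Matrix (Fin d) (Fin d) ℝ) : frob (r • M) = |r| * frob M := by
  simp only [frob_eq_norm]
  exact norm_smul r (WithLp.toLp 2 fun p : Fin d × Fin d => M p.1 p.2 :
    EuclideanSpace ℝ (Fin d × Fin d))

theorem sum_mul_le_frob (M M' : Matrix (Fin d) (Fin d) ℝ) :
    ∑ i, ∑ j, M i j * M' i j ≤ frob M * frob M' := by
  rw [frob_eq_norm, frob_eq_norm, mul_comm]
  refine le_trans (le_of_eq ?_) (real_inner_le_norm _ _)
  simp [PiLp.inner_apply, Fintype.sum_prod_type]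

theorem frob_le_supNorm (Φ : Tensor d J) (x : Grid d J) : frob (Φ x) ≤ supNorm Φ :=
  Finset.le_sup' (fun x => frob (Φ x)) (Finset.mem_univ x)

theorem supNorm_le_iff {Φ : Tensor d J} {m : ℝ} : supNorm Φ ≤ m ↔ ∀ x, frob (Φ x) ≤ m := by
  simp [supNorm, Finset.sup'_le_iff]

theorem sum_mul_onTensor (L : Op d J) (W : Matrix (Fin d) (Fin d) ℝ) (Φ : Tensor d J)
    (x : Grid d J) :
    ∑ i, ∑ j, W i j * Op.onTensor L Φ x i j = L (fun y => ∑ i, ∑ j, W i j * Φ y i j) x := by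
  have : (fun y => ∑ i, ∑ j, W i j * Φ y i j) = ∑ i, ∑ j, W i j • (fun y => Φ y i j) := by
    ext y
    simp [Finset.sum_apply]
  rw [this]
  simp [Op.onTensor, Finset.sum_apply]

/-- The maximum principle of one exponential step for tensor fields, in the Frobenius norm. -/
theorem frob_heat_step_le (h : ℝ) {K γ τ m : ℝ} (hK : 0 ≤ K) (hγ : 0 < γ) (hτ : 0 < τ)
    (hm : 0 ≤ m) {Φ N : Tensor d J} (hΦ : ∀ x, frob (Φ x) ≤ m) (hN : ∀ x, frob (N x) ≤ γ * m)
    (x : Grid d J) :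
    frob ((Op.onTensor (NormedSpace.exp (-(τ • (-(K • laplacian h) + γ • (1 : Op d J))))) Φ
      + τ • Op.onTensor (phi1 (-(τ • (-(K • laplacian h) + γ • (1 : Op d J))))) N) x) ≤ m := by
  set Z : Op d J := -(τ • (-(K • laplacian h) + γ • (1 : Op d J))) with hZ
  set W := (Op.onTensor (NormedSpace.exp Z) Φ + τ • Op.onTensor (phi1 Z) N) x with hW
  -- Contracting with the fixed matrix W commutes with operators acting componentwise. The scalar
  -- principle thus applies to W : Φ and W : N, which Cauchy–Schwarz bounds by |W|m and γ|W|m.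
  have key : frob W ^ 2 ≤ frob W * m := by
    have h1 : frob W ^ 2 = NormedSpace.exp Z (fun y => ∑ i, ∑ j, W i j * Φ y i j) x
        + τ * phi1 Z (fun y => ∑ i, ∑ j, W i j * N y i j) x := by
      rw [← sum_mul_onTensor, ← sum_mul_onTensor, frob_sq, Finset.mul_sum,
        ← Finset.sum_add_distrib]
      refine Finset.sum_congr rfl fun i _ => ?_
      rw [Finset.mul_sum, ← Finset.sum_add_distrib]
      refine Finset.sum_congr rfl fun j _ => ?_
      have : W i j = Op.onTensor (NormedSpace.exp Z) Φ x i j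
        + τ * Op.onTensor (phi1 Z) N x i j := rfl
      rw [sq]
      nth_rw 2 [this]
      ring
    rw [h1]
    refine heat_step_le h hK hγ hτ (fun y => ?_) (fun y => ?_) x
    · exact (sum_mul_le_frob _ _).trans (mul_le_mul_of_nonneg_left (hΦ y) (frob_nonneg _))
    · refine (sum_mul_le_frob _ _).trans ?_
      have := mul_le_mul_of_nonneg_left (hN y) (frob_nonneg W)
      linarith
  rcases (frob_nonneg W).eq_or_lt with h0 | h0
  · rw [← h0]; exact hm
  · rw [sq] at key
    exact le_of_mul_le_mul_left key h0

/-! ### Symmetric traceless tensor fields -/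

theorem IsQTensor.add {Φ Ψ : Tensor d J} (hΦ : IsQTensor Φ) (hΨ : IsQTensor Ψ) :
    IsQTensor (Φ + Ψ) := fun x =>
  ⟨(hΦ x).1.add (hΨ x).1, by
    rw [Pi.add_apply, Matrix.trace_add, (hΦ x).2, (hΨ x).2, add_zero]⟩

theorem IsQTensor.smul {Φ : Tensor d J} (hΦ : IsQTensor Φ) (r : ℝ) : IsQTensor (r • Φ) := fun x =>
  ⟨(hΦ x).1.smul r, by rw [Pi.smul_apply, Matrix.trace_smul, (hΦ x).2, smul_zero]⟩

theorem IsQTensor.neg {Φ : Tensor d J} (hΦ : IsQTensor Φ) : IsQTensor (-Φ) := fun x =>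
  ⟨(hΦ x).1.neg, by rw [Pi.neg_apply, Matrix.trace_neg, (hΦ x).2, neg_zero]⟩

theorem IsQTensor.onTensor {Φ : Tensor d J} (hΦ : IsQTensor Φ) (L : Op d J) :
    IsQTensor (Op.onTensor L Φ) := by
  intro x
  constructor
  · refine Matrix.IsSymm.ext fun i j => ?_
    simp only [Op.onTensor, Matrix.of_apply]
    have : (fun y => Φ y j i) = fun y => Φ y i j := funext fun y => (hΦ y).1.apply i j
    rw [this]
  · have h0 : (∑ i, fun y => Φ y i i) = (0 : Scalar d J) := by
      ext y
      rw [Finset.sum_apply]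
      exact (hΦ y).2
    have := congrFun (congrArg L h0) x
    rw [map_sum, map_zero, Finset.sum_apply] at this
    exact this

theorem dCentral_comm (h : ℝ) (k l : Fin d) (u : Scalar d J) :
    dCentral h k (dCentral h l u) = dCentral h l (dCentral h k u) := by
  ext x
  simp only [dCentral, LinearMap.smul_apply, LinearMap.sub_apply, Pi.smul_apply, Pi.sub_apply,
    shift_apply, smul_eq_mul, add_right_comm x (Pi.single k _) (Pi.single l _)]
  ring

theorem hessian_isSymm (h : ℝ) (u : Scalar d J) (x : Grid d J) : (hessian h u x).IsSymm := by
  refine Matrix.IsSymm.ext fun i j => ?_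
  simp only [hessian, Matrix.of_apply]
  rw [dCentral_comm]

theorem trace_sub_trace_div_smul_one (hd : d ≠ 0) (M : Matrix (Fin d) (Fin d) ℝ) :
    (M - (M.trace / (d : ℝ)) • (1 : Matrix (Fin d) (Fin d) ℝ)).trace = 0 := by
  have : (d : ℝ) ≠ 0 := Nat.cast_ne_zero.mpr hd
  rw [Matrix.trace_sub, Matrix.trace_smul, Matrix.trace_one, Fintype.card_fin, smul_eq_mul,
    div_mul_cancel₀ _ this, sub_self]

namespace Params

theorem Admissible.dim_ne_zero {p : Params} (hp : p.Admissible d) : d ≠ 0 := by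
  rcases hp.regime with h | h <;> omega

theorem forcing_isQTensor (p : Params) (hd : d ≠ 0) (h : ℝ) (u : Scalar d J) :
    IsQTensor (p.forcing h u) := by
  intro x
  refine ⟨(((hessian_isSymm h u x).smul _).sub (Matrix.isSymm_one.smul _)).smul _, ?_⟩
  rw [forcing, Matrix.trace_smul, trace_sub_trace_div_smul_one hd, smul_zero]

theorem varQ_isQTensor (p : Params) (hd : d ≠ 0) (h : ℝ) {Q : Tensor d J} (hQ : IsQTensor Q)
    (u : Scalar d J) : IsQTensor (p.varQ h Q u) := by
  intro x
  obtain ⟨hs, ht⟩ := hQ x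
  obtain ⟨hfs, hft⟩ := p.forcing_isQTensor hd h u x
  constructor
  · exact (((((hs.smul _).sub (((hs.pow 2).sub (Matrix.isSymm_one.smul _)).smul _)).add
      (hs.smul _)).add hfs).add (hs.smul _))
  · simp only [varQ, Matrix.trace_add, Matrix.trace_sub, Matrix.trace_smul, ht, hft]
    rw [← Matrix.trace_smul, ← Matrix.trace_sub, trace_sub_trace_div_smul_one hd]
    simp

theorem stepQ_isQTensor (p : Params) (hd : d ≠ 0) (h τ κ₁ : ℝ) {Q : Tensor d J} (hQ : IsQTensor Q)
    (u : Scalar d J) (s : ℝ) : IsQTensor (p.stepQ h τ κ₁ Q u s) :=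
  (hQ.onTensor _).add ((IsQTensor.onTensor
    ((((p.varQ_isQTensor hd h hQ u).smul _).neg).add (hQ.smul _)) _).smul τ)

theorem IsNumericalSolution.isQTensor {p : Params} (hd : d ≠ 0) {h η₀ τ κ₁ κ₂ : ℝ}
    {Q₀ : Tensor d J} {u₀ : Scalar d J} {Q : ℕ → Tensor d J} {u : ℕ → Scalar d J} {s : ℕ → ℝ}
    (hsol : p.IsNumericalSolution h η₀ τ κ₁ κ₂ Q₀ u₀ Q u s) (hQ₀ : IsQTensor Q₀) (n : ℕ) :
    IsQTensor (Q n) := by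
  induction n with
  | zero => rw [hsol.init_Q]; exact hQ₀
  | succ n ih => rw [hsol.step_Q]; exact p.stepQ_isQTensor hd h τ κ₁ ih _ _

end Params

/-! ### Pointwise bound of the nonlinear term -/

theorem trace_sq_eq_frob_sq {M : Matrix (Fin d) (Fin d) ℝ} (hM : M.IsSymm) :
    (M ^ 2).trace = frob M ^ 2 := by
  rw [frob_sq, sq, Matrix.trace]
  refine Finset.sum_congr rfl fun i _ => ?_
  rw [Matrix.diag_apply, Matrix.mul_apply]
  exact Finset.sum_congr rfl fun j _ => by rw [hM.apply i j, sq]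

/-- Cayley–Hamilton: a traceless 2 × 2 matrix satisfies M² = -det(M) I. Hence b₂ = 0. -/
theorem sq_sub_trace_eq_zero_of_dim_two {M : Matrix (Fin 2) (Fin 2) ℝ} (hM : M.IsSymm)
    (ht : M.trace = 0) :
    M ^ 2 - ((M ^ 2).trace / ((2 : ℕ) : ℝ)) • (1 : Matrix (Fin 2) (Fin 2) ℝ) = 0 := by
  have h10 : M 1 0 = M 0 1 := hM.apply 0 1
  rw [Matrix.trace_fin_two] at ht
  have h11 : M 1 1 = -M 0 0 := by linarith
  ext i j
  fin_cases i <;> fin_cases j <;>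
    simp [sq, Matrix.mul_apply, Fin.sum_univ_two, Matrix.trace_fin_two, h10, h11] <;> ring

/-- For a symmetric traceless 3 × 3 matrix tr M⁴ = (tr M²)²/2, so the squared norm is (1/2 -
1/3)|M|⁴ = |M|⁴/6. Hence b₃ = |B|/√6. The code checks the squared identity on the five free entries.
-/
theorem frob_sq_sub_trace_of_dim_three {M : Matrix (Fin 3) (Fin 3) ℝ} (hM : M.IsSymm)
    (ht : M.trace = 0) :
    frob (M ^ 2 - ((M ^ 2).trace / ((3 : ℕ) : ℝ)) • (1 : Matrix (Fin 3) (Fin 3) ℝ))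
      = frob M ^ 2 / √6 := by
  have h10 : M 1 0 = M 0 1 := hM.apply 0 1
  have h20 : M 2 0 = M 0 2 := hM.apply 0 2
  have h21 : M 2 1 = M 1 2 := hM.apply 1 2
  rw [Matrix.trace_fin_three] at ht
  have h22 : M 2 2 = -M 0 0 - M 1 1 := by linarith
  have hsq : frob (M ^ 2 - ((M ^ 2).trace / ((3 : ℕ) : ℝ)) • (1 : Matrix (Fin 3) (Fin 3) ℝ)) ^ 2
      = (frob M ^ 2 / √6) ^ 2 := by
    rw [div_pow, Real.sq_sqrt (by norm_num), frob_sq, frob_sq]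
    simp [sq, Matrix.mul_apply, Fin.sum_univ_three, Matrix.trace_fin_three, h10, h20, h21, h22]
    ring
  exact (pow_left_inj₀ (frob_nonneg _) (by positivity) two_ne_zero).mp hsq

namespace Params

variable {p : Params}

theorem bCoeff_nonneg (p : Params) (d : ℕ) : 0 ≤ p.bCoeff d := by
  unfold bCoeff
  split_ifs <;> positivity

theorem Admissible.frob_sq_sub_trace_le (hp : p.Admissible d) {M : Matrix (Fin d) (Fin d) ℝ}
    (hM : M.IsSymm) (ht : M.trace = 0) :
    frob (p.B • (M ^ 2 - ((M ^ 2).trace / (d : ℝ)) • (1 : Matrix (Fin d) (Fin d) ℝ)))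
      ≤ p.bCoeff d * frob M ^ 2 := by
  rw [frob_smul]
  rcases hp.regime with ⟨rfl, -⟩ | ⟨rfl, -⟩
  · rw [sq_sub_trace_eq_zero_of_dim_two hM ht]
    simp [frob, bCoeff]
  · rw [frob_sq_sub_trace_of_dim_three hM ht]
    simp [bCoeff]
    apply le_of_eq
    ring

theorem le_kappa0 (p : Params) (d : ℕ) (Amax η : ℝ) : Amax + p.C * η ^ 2 ≤ p.kappa0 d Amax η :=
  le_max_left _ _

theorem deriv_le_kappa0 (p : Params) (d : ℕ) (Amax : ℝ) {η ξ : ℝ} (hξ : ξ ∈ Set.Icc 0 η) :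
    p.A - 2 * p.bCoeff d * ξ + 3 * p.C * ξ ^ 2 ≤ p.kappa0 d Amax η := by
  refine le_trans (le_csSup ?_ (Set.mem_image_of_mem
    (fun ξ : ℝ => p.A - 2 * p.bCoeff d * ξ + 3 * p.C * ξ ^ 2) hξ)) (le_max_right _ _)
  exact (isCompact_Icc.image (by fun_prop)).bddAbove

/-- The second entry of κ₀ is the maximum of -f_d' on [0, η], so ξ ↦ κξ + f_d(ξ) is monotone there;
compare r with η. -/
theorem stabilized_fPoly_le {Amax η S κ r : ℝ} (hκ : p.kappa0 d Amax η ≤ κ)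
    (hf : p.fPoly d S η ≤ 0) (hr : r ∈ Set.Icc 0 η) : κ * r + p.fPoly d S r ≤ κ * η := by
  have hder : ∀ ξ : ℝ, HasDerivAt (fun ξ => κ * ξ + p.fPoly d S ξ)
      (κ - (p.A - 2 * p.bCoeff d * ξ + 3 * p.C * ξ ^ 2)) ξ := by
    intro ξ
    unfold fPoly
    have h1 := (hasDerivAt_id ξ).const_mul κ
    have h2 := (((hasDerivAt_id ξ).const_mul (-p.A)).add
      (((hasDerivAt_id ξ).pow 2).const_mul (p.bCoeff d))).sub
      (((hasDerivAt_id ξ).pow 3).const_mul p.C) |>.add_const S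
    convert! h1.add h2 using 1
    simp
    ring
  have hmono : MonotoneOn (fun ξ => κ * ξ + p.fPoly d S ξ) (Set.Icc 0 η) := by
    refine monotoneOn_of_deriv_nonneg (convex_Icc 0 η)
      (fun ξ _ => (hder ξ).continuousAt.continuousWithinAt)
      (fun ξ _ => (hder ξ).differentiableAt.differentiableWithinAt) fun ξ hξ => ?_
    rw [(hder ξ).deriv]
    linarith [p.deriv_le_kappa0 d Amax (interior_subset hξ)]
  have := hmono hr ⟨hr.1.trans hr.2, le_rfl⟩ hr.2
  simp only at this
  linarith

theorem Admissible.frob_stabilized_varQ_le (hp : p.Admissible d) {h Amax η S κ : ℝ}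
    {Q : Tensor d J} {u : Scalar d J} (hQ : IsQTensor Q) (hκ : p.kappa0 d Amax η ≤ κ)
    (hf : p.fPoly d S η ≤ 0) (hS : supNorm (p.forcing h u) ≤ S) (hA : ∀ x, p.aTilde u x ≤ Amax)
    {x : Grid d J} (hη : frob (Q x) ≤ η) :
    frob (-p.varQ h Q u x + κ • Q x) ≤ κ * η := by
  obtain ⟨hs, ht⟩ := hQ x
  have hr0 := frob_nonneg (Q x)
  -- All multiples of Q are collected in one coefficient, nonnegative by the first entry of κ₀. The
  -- triangle inequality then loses nothing on the stabilized part.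
  have hsplit : -p.varQ h Q u x + κ • Q x =
      (κ - p.aTilde u x - p.C * frob (Q x) ^ 2) • Q x
      + p.B • (Q x ^ 2 - ((Q x ^ 2).trace / (d : ℝ)) • (1 : Matrix (Fin d) (Fin d) ℝ))
      + -p.forcing h u x := by
    rw [varQ, ← trace_sq_eq_frob_sq hs, aTilde]
    module
  have hC := hp.C_pos
  have hrη : frob (Q x) ^ 2 ≤ η ^ 2 := pow_le_pow_left₀ hr0 hη 2
  have hcoef : 0 ≤ κ - p.aTilde u x - p.C * frob (Q x) ^ 2 := by
    have := p.le_kappa0 d Amax η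
    have := hA x
    have := mul_le_mul_of_nonneg_left hrη hC.le
    linarith
  -- f_d contains A rather than Ã; since the coupling only increases Ã, replacing Ã by A enlarges
  -- the coefficient.
  have hAt : p.A ≤ p.aTilde u x := by
    have := hp.B0_pos
    have := hp.q_pos
    unfold aTilde
    have : 0 ≤ 2 * p.B0 * p.q ^ 4 / p.sPlus d ^ 2 * u x ^ 2 := by positivity
    linarith
  rw [hsplit]
  refine (frob_add_le _ _).trans ?_
  have h1 := frob_add_le ((κ - p.aTilde u x - p.C * frob (Q x) ^ 2) • Q x)
    (p.B • (Q x ^ 2 - ((Q x ^ 2).trace / (d : ℝ)) • (1 : Matrix (Fin d) (Fin d) ℝ)))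
  have h2 := hp.frob_sq_sub_trace_le hs ht
  have h3 := (frob_le_supNorm (p.forcing h u) x).trans hS
  have h4 := stabilized_fPoly_le hκ hf ⟨hr0, hη⟩
  rw [frob_smul, abs_of_nonneg hcoef] at h1
  rw [frob_neg]
  unfold fPoly at h4
  have h5 := mul_le_mul_of_nonneg_right hAt hr0
  linarith

theorem gFactor_pos (p : Params) (h : ℝ) (Q : Tensor d J) (u : Scalar d J) (s : ℝ) :
    0 < p.gFactor h Q u s := div_pos (Real.exp_pos _) (Real.exp_pos _)

theorem gFactor_eq (p : Params) (h : ℝ) (Q : Tensor d J) (u : Scalar d J) (s : ℝ) :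
    p.gFactor h Q u s = Real.exp (s - p.energy1 h Q u) := (Real.exp_sub _ _).symm

/-- One step of the scheme preserves the bound `η`. -/
theorem Admissible.supNorm_stepQ_le (hp : p.Admissible d) {h τ κ₁ Amax η S G s : ℝ}
    {Q : Tensor d J} {u : Scalar d J} (hQ : IsQTensor Q) (hτ : 0 < τ) (hκ₁ : 0 < κ₁)
    (hκ : p.kappa0 d Amax η ≤ κ₁) (hη : 0 < η) (hf : p.fPoly d S η ≤ 0)
    (hb : p.LevelBounds h G S Amax Q u s) (hQη : supNorm Q ≤ η) :
    supNorm (p.stepQ h τ κ₁ Q u s) ≤ η := by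
  have hg := p.gFactor_pos h Q u s
  rw [supNorm_le_iff] at hQη ⊢
  refine frob_heat_step_le h hp.K_pos.le (mul_pos hg hκ₁) hτ hη.le hQη fun x => ?_
  have h1 := hp.frob_stabilized_varQ_le hQ hκ hf hb.forcing_le hb.aTilde_le (hQη x)
  have h2 : (-(p.gFactor h Q u s • p.varQ h Q u) + (p.gFactor h Q u s * κ₁) • Q) x
      = p.gFactor h Q u s • (-p.varQ h Q u x + κ₁ • Q x) := by
    simp only [Pi.add_apply, Pi.neg_apply, Pi.smul_apply]
    module
  rw [h2, frob_smul, abs_of_pos hg, mul_assoc]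
  exact mul_le_mul_of_nonneg_left h1 hg.le

theorem IsNumericalSolution.supNorm_le (hp : p.Admissible d) {h η₀ τ κ₁ κ₂ : ℝ}
    {Q₀ : Tensor d J} {u₀ : Scalar d J} {Q : ℕ → Tensor d J} {u : ℕ → Scalar d J} {s : ℕ → ℝ}
    (hsol : p.IsNumericalSolution h η₀ τ κ₁ κ₂ Q₀ u₀ Q u s) (hQ₀ : IsQTensor Q₀)
    (hτ : 0 < τ) (hκ₁ : 0 < κ₁) {N : ℕ∞} {G S Amax η : ℝ} (hG : 0 < G)
    (hb : ∀ n : ℕ, (n : ℕ∞) < N → p.LevelBounds h G S Amax (Q n) (u n) (s n))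
    (hη : 0 < η) (hf : p.fPoly d S η ≤ 0) (hQη : supNorm Q₀ ≤ η)
    (hκ : p.kappa0 d Amax η / G ≤ κ₁) (n : ℕ) (hn : (n : ℕ∞) ≤ N) : supNorm (Q n) ≤ η := by
  induction n with
  | zero => rw [hsol.init_Q]; exact hQη
  | succ n ih =>
    have hlt : (n : ℕ∞) < N :=
      lt_of_lt_of_le (by exact_mod_cast Nat.lt_succ_self n) hn
    -- s⁰ = E_{1h}(Q⁰, u⁰) gives g⁰ = 1, so the lower bound G is at most 1. As g multiplies both H
    -- and κ₁Q, the one-step bound needs only κ₀ ≤ κ₁.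
    have hG1 : G ≤ 1 := by
      have h0 := (hb 0 (lt_of_le_of_lt (by simp) hlt)).le_g
      rwa [gFactor_eq, hsol.init_s, hsol.init_Q, hsol.init_u, sub_self, Real.exp_zero] at h0
    have hκ' : p.kappa0 d Amax η ≤ κ₁ := by
      rw [div_le_iff₀ hG] at hκ
      exact hκ.trans (mul_le_of_le_one_right hκ₁.le hG1)
    rw [hsol.step_Q]
    exact hp.supNorm_stepQ_le (hsol.isQTensor hp.dim_ne_zero hQ₀ n) hτ hκ₁ hκ' hη hf (hb n hlt)
      (ih hlt.le)

theorem Admissible.exists_fPoly_nonpos (hp : p.Admissible d) (S : ℝ) :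
    ∃ ηmin : ℝ, 0 < ηmin ∧ ∀ η : ℝ, ηmin ≤ η → p.fPoly d S η ≤ 0 := by
  have hC := hp.C_pos
  have hb := p.bCoeff_nonneg d
  -- For η ≥ 1 the terms -Aη, b_dη² and S are each at most their absolute coefficient times η²; the
  -- witness makes Cη exceed the sum of these coefficients.
  refine ⟨1 + (|p.A| + p.bCoeff d + |S|) / p.C, by positivity, fun η hη => ?_⟩
  have h1 : 1 ≤ η := le_trans (by have : 0 ≤ (|p.A| + p.bCoeff d + |S|) / p.C := by positivity
                                  linarith) hη
  have h2 : |p.A| + p.bCoeff d + |S| ≤ p.C * η := by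
    have : (|p.A| + p.bCoeff d + |S|) / p.C ≤ η := by linarith
    rwa [div_le_iff₀' hC] at this
  have h3 := mul_le_mul_of_nonneg_right h2 (sq_nonneg η)
  have h4 : -p.A * η ≤ |p.A| * η ^ 2 := by
    have : -p.A * η ≤ |p.A| * η := mul_le_mul_of_nonneg_right (neg_le_abs _) (by linarith)
    exact this.trans (mul_le_mul_of_nonneg_left (by nlinarith) (abs_nonneg _))
  have h5 : S ≤ |S| * η ^ 2 :=
    (le_abs_self S).trans (le_mul_of_one_le_right (abs_nonneg _) (one_le_pow₀ h1))
  unfold fPoly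
  linarith

end Params

/-! ### Polynomial growth -/

/-- All entries of the state `(Q, u)` are bounded by `ρ`. -/
def EntriesLe (ρ : ℝ) (Q : Tensor d J) (u : Scalar d J) : Prop :=
  (∀ x i j, |Q x i j| ≤ ρ) ∧ ∀ x, |u x| ≤ ρ

/-- `F` grows at most like the `k`-th power of the size of the state. -/
def PolyBound (k : ℕ) (F : Tensor d J → Scalar d J → ℝ) : Prop :=
  ∃ c : ℝ, 0 ≤ c ∧ ∀ ρ : ℝ, 1 ≤ ρ → ∀ Q u, EntriesLe ρ Q u → |F Q u| ≤ c * ρ ^ k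

namespace PolyBound

variable {k l : ℕ} {F F' : Tensor d J → Scalar d J → ℝ}

theorem mono (hF : PolyBound k F) (hkl : k ≤ l) : PolyBound l F := by
  obtain ⟨c, hc, H⟩ := hF
  exact ⟨c, hc, fun ρ hρ Q u h => (H ρ hρ Q u h).trans
    (mul_le_mul_of_nonneg_left (pow_le_pow_right₀ hρ hkl) hc)⟩

theorem const (r : ℝ) : PolyBound k (fun (_ : Tensor d J) (_ : Scalar d J) => r) :=
  ⟨|r|, abs_nonneg r, fun _ hρ _ _ _ => le_mul_of_one_le_right (abs_nonneg r) (one_le_pow₀ hρ)⟩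

theorem entry (x : Grid d J) (i j : Fin d) : PolyBound 1 (fun Q (_ : Scalar d J) => Q x i j) :=
  ⟨1, zero_le_one, fun ρ _ Q u h => by simpa using h.1 x i j⟩

theorem value (x : Grid d J) : PolyBound 1 (fun (_ : Tensor d J) u => u x) :=
  ⟨1, zero_le_one, fun ρ _ Q u h => by simpa using h.2 x⟩

theorem add (hF : PolyBound k F) (hF' : PolyBound k F') :
    PolyBound k (fun Q u => F Q u + F' Q u) := by
  obtain ⟨c, hc, H⟩ := hF
  obtain ⟨c', hc', H'⟩ := hF'
  refine ⟨c + c', add_nonneg hc hc', fun ρ hρ Q u h => (abs_add_le _ _).trans ?_⟩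
  rw [add_mul]
  exact add_le_add (H ρ hρ Q u h) (H' ρ hρ Q u h)

theorem mul (hF : PolyBound k F) (hF' : PolyBound l F') :
    PolyBound (k + l) (fun Q u => F Q u * F' Q u) := by
  obtain ⟨c, hc, H⟩ := hF
  obtain ⟨c', hc', H'⟩ := hF'
  refine ⟨c * c', mul_nonneg hc hc', fun ρ hρ Q u h => ?_⟩
  have h0 : (0 : ℝ) ≤ ρ := zero_le_one.trans hρ
  rw [abs_mul, pow_add, mul_mul_mul_comm]
  exact mul_le_mul (H ρ hρ Q u h) (H' ρ hρ Q u h) (abs_nonneg _) (mul_nonneg hc (pow_nonneg h0 k))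

theorem const_mul (hF : PolyBound k F) (r : ℝ) : PolyBound k (fun Q u => r * F Q u) := by
  simpa using (const (k := 0) r).mul hF

theorem sub (hF : PolyBound k F) (hF' : PolyBound k F') :
    PolyBound k (fun Q u => F Q u - F' Q u) := by
  simpa [sub_eq_add_neg] using hF.add (hF'.const_mul (-1))

theorem pow (hF : PolyBound k F) (n : ℕ) : PolyBound (k * n) (fun Q u => F Q u ^ n) := by
  induction n with
  | zero => simpa using const (k := 0) (1 : ℝ)
  | succ n ih => simpa [pow_succ, Nat.mul_succ] using ih.mul hF

theorem sum {ι : Type*} (s : Finset ι) {F : ι → Tensor d J → Scalar d J → ℝ}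
    (hF : ∀ i, PolyBound k (F i)) : PolyBound k (fun Q u => ∑ i ∈ s, F i Q u) := by
  classical
  induction s using Finset.induction_on with
  | empty => simpa using const (k := k) (0 : ℝ)
  | insert i s hi ih => simpa [Finset.sum_insert hi] using (hF i).add ih

/-- On a finite grid T acts by a matrix, so the growth order is kept; this covers all difference
operators at once. -/
theorem linear {F : Tensor d J → Scalar d J → Scalar d J} (T : Scalar d J →ₗ[ℝ] Scalar d J)
    (hF : ∀ x, PolyBound k (fun Q u => F Q u x)) (x : Grid d J) :
    PolyBound k (fun Q u => T (F Q u) x) := by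
  classical
  have : ∀ U : Scalar d J, T U x = ∑ y, T (Pi.single y 1) x * U y := by
    intro U
    have h1 : U = ∑ y, U y • (Pi.single y 1 : Scalar d J) := by
      ext z
      simp [Finset.sum_apply, Pi.single_apply]
    conv_lhs => rw [h1]
    simp [Finset.sum_apply, mul_comm]
  rw [show (fun Q u => T (F Q u) x) = fun Q u => ∑ y, T (Pi.single y 1) x * F Q u y from
    funext fun Q => funext fun u => this (F Q u)]
  exact sum _ fun y => (hF y).const_mul _

/-- A finite family of polynomially bounded functions has a common constant. -/
theorem uniform {ι : Type*} [Fintype ι] {F : ι → Tensor d J → Scalar d J → ℝ}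
    (hF : ∀ i, PolyBound k (F i)) :
    ∃ c : ℝ, 0 ≤ c ∧ ∀ i, ∀ ρ : ℝ, 1 ≤ ρ → ∀ Q u, EntriesLe ρ Q u → |F i Q u| ≤ c * ρ ^ k := by
  choose c hc H using hF
  refine ⟨∑ i, c i, Finset.sum_nonneg fun i _ => hc i, fun i ρ hρ Q u h => ?_⟩
  refine (H i ρ hρ Q u h).trans (mul_le_mul_of_nonneg_right ?_ (by positivity))
  exact Finset.single_le_sum (fun j _ => hc j) (Finset.mem_univ i)

theorem hessian_entry (h : ℝ) (x : Grid d J) (i j : Fin d) :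
    PolyBound 1 (fun (_ : Tensor d J) u => hessian h u x i j) :=
  linear (F := fun _ u => dCentral h j u) (dCentral h i)
    (linear (F := fun _ u => u) (dCentral h j) value) x

theorem sq_entry (x : Grid d J) (i j : Fin d) :
    PolyBound 2 (fun Q (_ : Scalar d J) => (Q x ^ 2) i j) := by
  simp only [_root_.sq, Matrix.mul_apply]
  exact sum _ fun k => (entry x i k).mul (entry x k j)

theorem sq_trace (x : Grid d J) :
    PolyBound 2 (fun Q (_ : Scalar d J) => (Q x ^ 2).trace) :=
  sum _ fun i => sq_entry x i i

theorem cube_trace (x : Grid d J) :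
    PolyBound 3 (fun Q (_ : Scalar d J) => (Q x ^ 3).trace) := by
  simp only [pow_succ _ 2, Matrix.trace, Matrix.diag_apply, Matrix.mul_apply]
  exact sum _ fun i => sum _ fun k => (sq_entry x i k).mul (entry x k i)

theorem orient_entry (p : Params) (x : Grid d J) (i j : Fin d) :
    PolyBound 1 (fun Q (_ : Scalar d J) => p.orient Q x i j) := by
  simp only [Params.orient, Matrix.add_apply, Matrix.smul_apply, smul_eq_mul]
  exact ((entry x i j).const_mul _).add (const _)

theorem forcing_entry (p : Params) (h : ℝ) (x : Grid d J) (i j : Fin d) :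
    PolyBound 2 (fun (_ : Tensor d J) u => p.forcing h u x i j) := by
  simp only [Params.forcing, Matrix.sub_apply, Matrix.smul_apply, smul_eq_mul, Matrix.trace,
    Matrix.diag_apply, div_eq_mul_inv]
  refine (((value x).mul (hessian_entry h x i j)).sub ?_).const_mul _
  have h1 : PolyBound 2 (fun (_ : Tensor d J) u => ∑ i, u x * hessian h u x i i) :=
    sum _ fun i => (value x).mul (hessian_entry h x i i)
  exact (h1.mul (const (k := 0) _)).mul (const (k := 0) _)

theorem aTilde (p : Params) (x : Grid d J) :
    PolyBound 2 (fun (_ : Tensor d J) u => p.aTilde u x) := by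
  unfold Params.aTilde
  exact (const _).add (((value x).pow 2).const_mul _)

theorem varQ_entry (p : Params) (h : ℝ) (x : Grid d J) (i j : Fin d) :
    PolyBound 3 (fun Q u => p.varQ h Q u x i j) := by
  simp only [Params.varQ, Matrix.add_apply, Matrix.sub_apply, Matrix.smul_apply, smul_eq_mul,
    div_eq_mul_inv]
  have h13 : 1 ≤ 3 := by norm_num
  have h23 : 2 ≤ 3 := by norm_num
  refine ((((((entry x i j).const_mul _).mono h13).sub ?_).add ?_).add
    ((forcing_entry p h x i j).mono h23)).add ?_
  · exact (((sq_entry x i j).sub (((sq_trace x).mul (const (k := 0) _)).mul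
      (const (k := 0) _))).const_mul _).mono h23
  · exact ((sq_trace x).const_mul _).mul (entry x i j)
  · exact (((value x).pow 2).const_mul _).mul (entry x i j)

theorem varU_value (p : Params) (h : ℝ) (x : Grid d J) :
    PolyBound 3 (fun Q u => p.varU h Q u x) := by
  unfold Params.varU
  have h13 : 1 ≤ 3 := by norm_num
  have h23 : 2 ≤ 3 := by norm_num
  have hM := orient_entry (d := d) (J := J) p
  refine ((((((((value x).const_mul _).mono h13)).add ((((value x).pow 2).const_mul _).mono
    h23)).add (((value x).pow 3).const_mul _)).add ?_).add ?_).add ?_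
  · exact ((sum _ fun i => sum _ fun j => (hM x i j).mul (hessian_entry h x i j)).const_mul
      _).mono h23
  · refine PolyBound.mono (k := 2) (const_mul ?_ _) h23
    simp only [divDiv, Finset.sum_apply]
    refine sum _ fun k => linear
      (F := fun Q u => ∑ l : Fin d, dMinus h l (fun y => (u y • p.orient Q y) k l)) (dMinus h k)
      (fun y => ?_) x
    simp only [Finset.sum_apply]
    exact sum _ fun l => linear (F := fun Q u y => (u y • p.orient Q y) k l) (dMinus h l)
      (fun z => (value z).mul (hM z k l)) y
  · have h1 : PolyBound 2 (fun Q (_ : Scalar d J) => ∑ i, ∑ j, p.orient Q x i j ^ 2) :=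
      sum _ fun i => sum _ fun j => (hM x i j).pow 2
    exact (h1.const_mul _).mul (value x)

theorem coupling (p : Params) (h : ℝ) :
    PolyBound 3 (fun (Q : Tensor d J) u => innerT h (hessian h u) (fun x => u x • p.orient Q x)) := by
  unfold innerT inner
  exact sum _ fun i => sum _ fun j => (sum _ fun x =>
    (hessian_entry h x i j).mul ((value x).mul (orient_entry p x i j))).const_mul _

theorem penalty (p : Params) (h : ℝ) :
    PolyBound 4 (fun (Q : Tensor d J) u => innerT h (fun x => u x • p.orient Q x)
      (fun x => u x • p.orient Q x)) := by
  unfold innerT inner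
  exact sum _ fun i => sum _ fun j => (sum _ fun x =>
    ((value x).mul (orient_entry p x i j)).mul
      ((value x).mul (orient_entry p x i j))).const_mul _

end PolyBound

/-! ### Coercivity of the nonlinear energy -/

namespace Params

/-- The part of the bulk energy densities of degree at most three. -/
def lowerBulk (p : Params) (Q : Tensor d J) (u : Scalar d J) (x : Grid d J) : ℝ :=
  p.A / 2 * (Q x ^ 2).trace - (if d = 2 then 0 else p.B / 3) * (Q x ^ 3).trace
    + p.a / 2 * u x ^ 2 + p.b / 3 * u x ^ 3

/-- The quartic part of the bulk energy densities. -/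
def quarticBulk (p : Params) (Q : Tensor d J) (u : Scalar d J) (x : Grid d J) : ℝ :=
  p.C / 4 * (Q x ^ 2).trace ^ 2 + p.c / 4 * u x ^ 4

theorem energy1_eq (p : Params) (h : ℝ) (Q : Tensor d J) (u : Scalar d J) :
    p.energy1 h Q u =
      2 * p.B0 * p.q ^ 2 * innerT h (hessian h u) (fun x => u x • p.orient Q x)
      + p.B0 * p.q ^ 4 * innerT h (fun x => u x • p.orient Q x) (fun x => u x • p.orient Q x)
      + h ^ d * ∑ x, p.lowerBulk Q u x + h ^ d * ∑ x, p.quarticBulk Q u x := by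
  have : ∀ x, p.fbn (Q x) + p.fs (u x) = p.lowerBulk Q u x + p.quarticBulk Q u x := by
    intro x
    unfold fbn fs lowerBulk quarticBulk
    split_ifs <;> ring
  unfold energy1
  simp only [inner, Pi.one_apply, mul_one]
  rw [add_assoc, add_assoc (_ + _), ← mul_add, ← mul_add, ← Finset.sum_add_distrib,
    ← Finset.sum_add_distrib, Finset.sum_congr rfl fun x _ => this x]

theorem lowerBulk_polyBound (p : Params) (x : Grid d J) :
    PolyBound 3 (fun Q u => p.lowerBulk Q u x) := by
  unfold lowerBulk
  have h23 : 2 ≤ 3 := by norm_num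
  exact (((((PolyBound.sq_trace x).const_mul _).mono h23).sub
    ((PolyBound.cube_trace x).const_mul _)).add ((((PolyBound.value x).pow 2).const_mul _).mono
    h23)).add (((PolyBound.value x).pow 3).const_mul _)

theorem energy1_polyBound (p : Params) (h : ℝ) :
    PolyBound 4 (fun (Q : Tensor d J) u => p.energy1 h Q u) := by
  simp only [energy1_eq]
  have h34 : 3 ≤ 4 := by norm_num
  refine (((((PolyBound.coupling p h).const_mul _).mono h34).add
    ((PolyBound.penalty p h).const_mul _)).add
    (((PolyBound.sum _ fun x => p.lowerBulk_polyBound x).const_mul _).mono h34)).add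
    ((PolyBound.sum _ fun x => ?_).const_mul _)
  unfold quarticBulk
  exact (((PolyBound.sq_trace x).pow 2).const_mul _).add
    (((PolyBound.value x).pow 4).const_mul _)

theorem innerT_self_nonneg {h : ℝ} (hh : 0 ≤ h) (Φ : Tensor d J) : 0 ≤ innerT h Φ Φ :=
  Finset.sum_nonneg fun _ _ => Finset.sum_nonneg fun _ _ => mul_nonneg (pow_nonneg hh d)
    (Finset.sum_nonneg fun _ _ => mul_self_nonneg _)

theorem exists_size (Q : Tensor d J) (u : Scalar d J) :
    ∃ ρ : ℝ, 1 ≤ ρ ∧ EntriesLe ρ Q u ∧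
      (ρ = 1 ∨ (∃ x i j, |Q x i j| = ρ) ∨ ∃ x, |u x| = ρ) := by
  -- ρ is the maximum of 1 and all absolute entries. That it is attained is what lets a single grid
  -- point control the quartic energy from below.
  let f : Unit ⊕ (Grid d J × Fin d × Fin d) ⊕ Grid d J → ℝ :=
    Sum.elim (fun _ => 1) (Sum.elim (fun y => |Q y.1 y.2.1 y.2.2|) fun x => |u x|)
  obtain ⟨i₀, hi₀⟩ := Finite.exists_max f
  refine ⟨f i₀, hi₀ (Sum.inl ()), ⟨fun x i j => hi₀ (Sum.inr (Sum.inl (x, i, j))),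
    fun x => hi₀ (Sum.inr (Sum.inr x))⟩, ?_⟩
  rcases i₀ with _ | ⟨x, i, j⟩ | x
  · exact Or.inl rfl
  · exact Or.inr (Or.inl ⟨x, i, j, rfl⟩)
  · exact Or.inr (Or.inr ⟨x, rfl⟩)

theorem quarticBulk_nonneg {p : Params} (hp : p.Admissible d) (Q : Tensor d J) (u : Scalar d J)
    (x : Grid d J) : 0 ≤ p.quarticBulk Q u x := by
  have := hp.C_pos
  have := hp.c_pos
  unfold quarticBulk
  positivity

theorem abs_entry_le_frob (M : Matrix (Fin d) (Fin d) ℝ) (i j : Fin d) : |M i j| ≤ frob M := by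
  rw [frob_eq_norm]
  simpa using PiLp.norm_apply_le (WithLp.toLp 2 fun p : Fin d × Fin d => M p.1 p.2 :
      EuclideanSpace ℝ (Fin d × Fin d)) (i, j)

theorem Admissible.quartic_lower_bound {p : Params} (hp : p.Admissible d) {Q : Tensor d J}
    (hQ : IsQTensor Q) (u : Scalar d J) {ρ : ℝ}
    (hρ : ρ = 1 ∨ (∃ x i j, |Q x i j| = ρ) ∨ ∃ x, |u x| = ρ) :
    min p.C p.c / 4 * (ρ ^ 4 - ρ ^ 3) ≤ ∑ x, p.quarticBulk Q u x ∨
      min p.C p.c / 4 * ρ ^ 4 ≤ ∑ x, p.quarticBulk Q u x := by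
  have hnn := quarticBulk_nonneg hp Q u
  have hC := hp.C_pos
  have hc := hp.c_pos
  have hsingle : ∀ x, p.quarticBulk Q u x ≤ ∑ x, p.quarticBulk Q u x := fun x =>
    Finset.single_le_sum (f := fun x => p.quarticBulk Q u x) (fun y _ => hnn y) (Finset.mem_univ x)
  -- For ρ = 1 no entry need be large, but then ρ⁴ - ρ³ = 0; otherwise the point where ρ is attained
  -- already contributes a multiple of ρ⁴.
  rcases hρ with rfl | ⟨x, i, j, hx⟩ | ⟨x, hx⟩
  · left
    have : 0 ≤ ∑ x, p.quarticBulk Q u x := Finset.sum_nonneg fun x _ => hnn x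
    simpa using this
  · right
    refine le_trans ?_ (hsingle x)
    rw [quarticBulk, trace_sq_eq_frob_sq (hQ x).1, ← pow_mul]
    have h1 : ρ ^ 4 ≤ frob (Q x) ^ 4 := by
      rw [← hx]
      exact pow_le_pow_left₀ (abs_nonneg _) (abs_entry_le_frob _ _ _) 4
    have h2 : min p.C p.c / 4 ≤ p.C / 4 := by linarith [min_le_left p.C p.c]
    have h3 : (0 : ℝ) ≤ ρ ^ 4 := by positivity
    have h4 := mul_le_mul h2 h1 h3 (by positivity)
    have : 0 ≤ p.c / 4 * u x ^ 4 := by positivity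
    norm_num
    linarith
  · right
    refine le_trans ?_ (hsingle x)
    have h1 : ρ ^ 4 = u x ^ 4 := by rw [← hx, Even.pow_abs (by decide)]
    have h2 : min p.C p.c / 4 ≤ p.c / 4 := by linarith [min_le_right p.C p.c]
    have h3 : (0 : ℝ) ≤ u x ^ 4 := by positivity
    have h4 := mul_le_mul_of_nonneg_right h2 h3
    have : 0 ≤ p.C / 4 * (Q x ^ 2).trace ^ 2 := by positivity
    rw [quarticBulk, h1]
    linarith

theorem cube_le_quartic {c₀ c₁ ρ : ℝ} (hc₀ : 0 < c₀) (hc₁ : 0 ≤ c₁) (hρ : 0 ≤ ρ) :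
    c₁ * ρ ^ 3 ≤ c₀ * ρ ^ 4 + c₁ * (c₁ / c₀) ^ 3 := by
  rcases le_total (c₁ / c₀) ρ with h | h
  · rw [div_le_iff₀' hc₀] at h
    have h1 := mul_le_mul_of_nonneg_right h (pow_nonneg hρ 3)
    have h2 : 0 ≤ c₁ * (c₁ / c₀) ^ 3 := by positivity
    nlinarith
  · have h1 := mul_le_mul_of_nonneg_left (pow_le_pow_left₀ hρ h 3) hc₁
    have h2 : 0 ≤ c₀ * ρ ^ 4 := by positivity
    linarith

/-- The nonlinear energy controls the third power of the size of the state. -/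
theorem Admissible.energy1_coercive {p : Params} (hp : p.Admissible d) {h : ℝ} (hh : 0 < h) :
    ∃ β : ℝ, 0 ≤ β ∧ ∀ Q : Tensor d J, IsQTensor Q → ∀ u : Scalar d J,
      ∃ ρ : ℝ, 1 ≤ ρ ∧ EntriesLe ρ Q u ∧ ρ ^ 3 - β ≤ p.energy1 h Q u := by
  have hlow : PolyBound 3 (fun (Q : Tensor d J) u =>
      2 * p.B0 * p.q ^ 2 * innerT h (hessian h u) (fun x => u x • p.orient Q x)
      + h ^ d * ∑ x, p.lowerBulk Q u x) :=
    ((PolyBound.coupling p h).const_mul _).add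
      ((PolyBound.sum _ fun x => p.lowerBulk_polyBound x).const_mul _)
  obtain ⟨c, hc, H⟩ := hlow
  have hC := hp.C_pos
  have hc' := hp.c_pos
  set m := h ^ d * (min p.C p.c / 4) with hm
  have hm0 : 0 < m := by have := lt_min hC hc'; positivity
  -- The energy is at least mρ⁴ - (c + m)ρ³: c bounds the cubic terms, the extra m comes from the
  -- defect ρ⁴ - ρ³, and the penalty is nonnegative. The added 1 leaves ρ³, and β is the remainder
  -- in `cube_le_quartic`.
  refine ⟨(c + m + 1) * ((c + m + 1) / m) ^ 3, by positivity, fun Q hQ u => ?_⟩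
  obtain ⟨ρ, hρ1, hρ, hatt⟩ := exists_size Q u
  refine ⟨ρ, hρ1, hρ, ?_⟩
  have h1 := (abs_le.mp (H ρ hρ1 Q u hρ)).1
  have hpen : 0 ≤ p.B0 * p.q ^ 4 * innerT h (fun x => u x • p.orient Q x)
      (fun x => u x • p.orient Q x) := by
    have := hp.B0_pos
    have := innerT_self_nonneg hh.le (fun x => u x • p.orient Q x)
    positivity
  have hq : m * (ρ ^ 4 - ρ ^ 3) ≤ h ^ d * ∑ x, p.quarticBulk Q u x := by
    rw [hm, mul_assoc]
    refine mul_le_mul_of_nonneg_left ?_ (by positivity)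
    rcases hp.quartic_lower_bound hQ u hatt with h2 | h2
    · exact h2
    · refine le_trans (mul_le_mul_of_nonneg_left ?_ ?_) h2
      · have : 0 ≤ ρ ^ 3 := by positivity
        linarith
      · have := lt_min hC hc'; positivity
  have hcube := cube_le_quartic (c₁ := c + m + 1) hm0 (by positivity) (zero_le_one.trans hρ1)
  rw [energy1_eq]
  linarith

end Params

/-- The grid function formed by one entry of a tensor field. -/
def comp (Φ : Tensor d J) (i j : Fin d) : Scalar d J := fun x => Φ x i j

theorem innerT_eq (h : ℝ) (Φ Ψ : Tensor d J) :
    innerT h Φ Ψ = ∑ i, ∑ j, h ^ d * (comp Φ i j ⬝ᵥ comp Ψ i j) := rfl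

theorem inner_eq (h : ℝ) (U V : Scalar d J) : inner h U V = h ^ d * (U ⬝ᵥ V) := rfl

theorem LaplaceBasis.apply_opQ {h : ℝ} {b : Grid d J → Scalar d J} {ev : Grid d J → ℝ}
    (hb : LaplaceBasis h b ev) (K : ℝ) (i : Grid d J) :
    (-(K • laplacian h) : Op d J) (b i) = (K * ev i) • b i := by
  rw [neg_apply, smul_apply, hb.eigen, smul_smul, ← neg_smul]
  congr 1
  ring

theorem LaplaceBasis.apply_opU {h : ℝ} {b : Grid d J → Scalar d J} {ev : Grid d J → ℝ}
    (hb : LaplaceBasis h b ev) (r : ℝ) (i : Grid d J) :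
    (r • (laplacian h * laplacian h) : Op d J) (b i) = (r * ev i ^ 2) • b i := by
  rw [smul_apply, mul_apply_eq_comp, hb.eigen, map_smul, hb.eigen, smul_smul, smul_smul]
  congr 1
  ring

namespace Params

variable {p : Params} {h η₀ τ κ₁ κ₂ : ℝ}

theorem comp_stepQ (p : Params) (h τ κ₁ : ℝ) (Q : Tensor d J) (u : Scalar d J) (s : ℝ)
    (i j : Fin d) :
    comp (p.stepQ h τ κ₁ Q u s) i j =
      (NormedSpace.exp (-(τ • (-(p.K • laplacian h)
        + (p.gFactor h Q u s * κ₁) • (1 : Op d J)))) : Op d J) (comp Q i j)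
      + τ • phi1 (-(τ • (-(p.K • laplacian h) + (p.gFactor h Q u s * κ₁) • (1 : Op d J))))
        (-(p.gFactor h Q u s • comp (p.varQ h Q u) i j)
          + (p.gFactor h Q u s * κ₁) • comp Q i j) := rfl

theorem stepU_eq (p : Params) (h τ κ₂ : ℝ) (Q : Tensor d J) (u : Scalar d J) (s : ℝ) :
    p.stepU h τ κ₂ Q u s =
      (NormedSpace.exp (-(τ • ((2 * p.B0) • (laplacian h * laplacian h)
        + (p.gFactor h Q u s * κ₂) • (1 : Op d J)))) : Op d J) u
      + τ • phi1 (-(τ • ((2 * p.B0) • (laplacian h * laplacian h)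
          + (p.gFactor h Q u s * κ₂) • (1 : Op d J))))
        (-(p.gFactor h Q u s • p.varU h Q u) + (p.gFactor h Q u s * κ₂) • u) := rfl

/-! ### The modified energy law -/

/-- The modified energy: the quadratic part of the discrete energy plus the auxiliary variable. -/
def modEnergy (p : Params) (h : ℝ) (Q : Tensor d J) (u : Scalar d J) (s : ℝ) : ℝ :=
  (∑ i, ∑ j, h ^ d * (1 / 2 * ((-(p.K • laplacian h) : Op d J) (comp Q i j) ⬝ᵥ comp Q i j)))
    + h ^ d * (1 / 2 * (((2 * p.B0) • (laplacian h * laplacian h) : Op d J) u ⬝ᵥ u)) + s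

theorem Admissible.le_modEnergy (hp : p.Admissible d) (hh : 0 < h) (Q : Tensor d J)
    (u : Scalar d J) (s : ℝ) : s ≤ p.modEnergy h Q u s := by
  have hK := hp.K_pos
  have hB := hp.B0_pos
  have h1 : 0 ≤ ∑ i, ∑ j,
      h ^ d * (1 / 2 * ((-(p.K • laplacian h) : Op d J) (comp Q i j) ⬝ᵥ comp Q i j)) := by
    refine Finset.sum_nonneg fun i _ => Finset.sum_nonneg fun j _ => ?_
    have := mul_nonneg hK.le (neg_nonneg.mpr (laplacian_dotProduct_self_nonpos h (comp Q i j)))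
    rw [neg_apply, smul_apply, neg_dotProduct, smul_dotProduct, smul_eq_mul, ← mul_neg]
    positivity
  have h2 : 0 ≤ h ^ d *
      (1 / 2 * (((2 * p.B0) • (laplacian h * laplacian h) : Op d J) u ⬝ᵥ u)) := by
    rw [smul_apply, mul_apply_eq_comp, smul_dotProduct, laplacian_dotProduct_comm, smul_eq_mul]
    have : 0 ≤ laplacian h u ⬝ᵥ laplacian h u := Finset.sum_nonneg fun _ _ => mul_self_nonneg _
    positivity
  unfold modEnergy
  linarith

/-- Summed over components, the mode inequalities say that the quadratic energy plus s̃ drops by at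
least ℛ. Replacing s̃ by s' costs at most η₀τℛ. -/
theorem Admissible.modEnergy_step_le (hp : p.Admissible d) (hh : 0 < h)
    (hη₀ : η₀ ∈ Set.Icc (0 : ℝ) 1) (hτ : 0 < τ) (hτ1 : τ ≤ 1) (hκ₁ : 0 < κ₁) (hκ₂ : 0 < κ₂)
    {Q Q' : Tensor d J} {u u' : Scalar d J} {s s' : ℝ} (hQ' : Q' = p.stepQ h τ κ₁ Q u s)
    (hu' : u' = p.stepU h τ κ₂ Q u s)
    (hs' : s' - p.provisionalS h Q u s Q' u' ≤ η₀ * τ * p.dissipation h τ κ₁ κ₂ Q u s Q' u') :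
    p.modEnergy h Q' u' s' ≤ p.modEnergy h Q u s := by
  obtain ⟨b, ev, hb⟩ := exists_laplaceBasis (d := d) (J := J) h
  have hg := p.gFactor_pos h Q u s
  have hhd : 0 ≤ h ^ d := by positivity
  have hlQ : ∀ i, 0 ≤ p.K * ev i := fun i => mul_nonneg hp.K_pos.le (hb.nonneg i)
  have hlU : ∀ i, 0 ≤ 2 * p.B0 * ev i ^ 2 := fun i => by
    have := hp.B0_pos
    positivity
  have eQ : ∀ i j, comp (Q' - Q) i j = comp Q' i j - comp Q i j := fun _ _ => rfl
  have hstepQ := fun i j => hb.step_energy_le (hb.apply_opQ p.K) hlQ (mul_pos hg hκ₁) hτ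
    ((congrArg (comp · i j) hQ').trans (p.comp_stepQ h τ κ₁ Q u s i j))
  have hstepU := hb.step_energy_le (hb.apply_opU (2 * p.B0)) hlU (mul_pos hg hκ₂) hτ
    (hu'.trans (p.stepU_eq h τ κ₂ Q u s))
  have hsumQ := Finset.sum_nonpos fun i (_ : i ∈ Finset.univ) =>
    Finset.sum_nonpos fun j (_ : j ∈ Finset.univ) =>
      mul_nonpos_of_nonneg_of_nonpos hhd (hstepQ i j)
  have hsumU := mul_nonpos_of_nonneg_of_nonpos hhd hstepU
  have hqQ : 0 ≤ ∑ i, ∑ j, h ^ d * (calQ1 (τ • p.opQ h (p.gFactor h Q u s) κ₁) (comp (Q' - Q) i j)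
      ⬝ᵥ comp (Q' - Q) i j) :=
    Finset.sum_nonneg fun i _ => Finset.sum_nonneg fun j _ => mul_nonneg hhd
      (hb.calQ1_dotProduct_nonneg (hb.apply_opQ p.K) hlQ (mul_pos hg hκ₁) hτ _)
  have hqU : 0 ≤ h ^ d * (calQ1 (τ • p.opU h (p.gFactor h Q u s) κ₂) (u' - u) ⬝ᵥ (u' - u)) :=
    mul_nonneg hhd
      (hb.calQ1_dotProduct_nonneg (hb.apply_opU (2 * p.B0)) hlU (mul_pos hg hκ₂) hτ _)
  have hdiss : p.dissipation h τ κ₁ κ₂ Q u s Q' u' = 1 / τ *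
      (∑ i, ∑ j, h ^ d * (calQ1 (τ • p.opQ h (p.gFactor h Q u s) κ₁) (comp (Q' - Q) i j)
        ⬝ᵥ comp (Q' - Q) i j)
      + h ^ d * (calQ1 (τ • p.opU h (p.gFactor h Q u s) κ₂) (u' - u) ⬝ᵥ (u' - u))) := rfl
  have hR0 : 0 ≤ p.dissipation h τ κ₁ κ₂ Q u s Q' u' := by
    rw [hdiss]
    exact mul_nonneg (one_div_pos.mpr hτ).le (add_nonneg hqQ hqU)
  -- This is where τ ≤ 1 enters: η₀τ ≤ 1 and ℛ ≥ 0.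
  have hR : η₀ * τ * p.dissipation h τ κ₁ κ₂ Q u s Q' u'
      ≤ p.dissipation h τ κ₁ κ₂ Q u s Q' u' :=
    mul_le_of_le_one_left hR0 (mul_le_one₀ hη₀.2 hτ.le hτ1)
  have hprov : p.provisionalS h Q u s Q' u' = s +
      (∑ i, ∑ j, h ^ d * ((p.gFactor h Q u s • comp (p.varQ h Q u) i j) ⬝ᵥ comp (Q' - Q) i j)
      + h ^ d * ((p.gFactor h Q u s • p.varU h Q u) ⬝ᵥ (u' - u))) := by
    rw [provisionalS, innerT_eq, inner_eq, mul_add, Finset.mul_sum]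
    simp only [Finset.mul_sum, smul_dotProduct, smul_eq_mul]
    simp only [mul_left_comm]
  have hsplitQ : ∑ i, ∑ j, h ^ d *
      ((p.gFactor h Q u s • comp (p.varQ h Q u) i j) ⬝ᵥ comp (Q' - Q) i j)
      + ∑ i, ∑ j, h ^ d * (1 / 2 * ((-(p.K • laplacian h) : Op d J) (comp Q' i j) ⬝ᵥ comp Q' i j))
      - ∑ i, ∑ j, h ^ d * (1 / 2 * ((-(p.K • laplacian h) : Op d J) (comp Q i j) ⬝ᵥ comp Q i j))
      + 1 / τ * ∑ i, ∑ j, h ^ d *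
        (calQ1 (τ • p.opQ h (p.gFactor h Q u s) κ₁) (comp (Q' - Q) i j) ⬝ᵥ comp (Q' - Q) i j)
      ≤ 0 := by
    refine le_trans (le_of_eq ?_) hsumQ
    simp only [Finset.mul_sum, ← Finset.sum_add_distrib, ← Finset.sum_sub_distrib]
    refine Finset.sum_congr rfl fun i _ => Finset.sum_congr rfl fun j _ => ?_
    rw [eQ]
    unfold opQ
    ring
  unfold modEnergy
  unfold opU at hdiss hqU
  rw [hprov] at hs'
  linarith

/-! ### Bounds on bounded time intervals -/

/-- `ℓ²` bounds of all components of the state. -/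
def FieldLe (R : ℝ) (Q : Tensor d J) (u : Scalar d J) : Prop :=
  (∀ i j, l2 (comp Q i j) ≤ R) ∧ l2 u ≤ R

theorem FieldLe.mono {R R' : ℝ} {Q : Tensor d J} {u : Scalar d J} (hF : FieldLe R Q u)
    (hR : R ≤ R') : FieldLe R' Q u :=
  ⟨fun i j => (hF.1 i j).trans hR, hF.2.trans hR⟩

theorem exists_fieldLe (Q : Tensor d J) (u : Scalar d J) : ∃ R : ℝ, 0 ≤ R ∧ FieldLe R Q u := by
  have h0 : 0 ≤ ∑ i, ∑ j, l2 (comp Q i j) :=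
    Finset.sum_nonneg fun _ _ => Finset.sum_nonneg fun _ _ => l2_nonneg _
  refine ⟨∑ i, ∑ j, l2 (comp Q i j) + l2 u, add_nonneg h0 (l2_nonneg u), fun i j => ?_, ?_⟩
  · have h1 : l2 (comp Q i j) ≤ ∑ j, l2 (comp Q i j) :=
      Finset.single_le_sum (f := fun j => l2 (comp Q i j)) (fun _ _ => l2_nonneg _)
        (Finset.mem_univ j)
    have h2 : ∑ j, l2 (comp Q i j) ≤ ∑ i, ∑ j, l2 (comp Q i j) :=
      Finset.single_le_sum (f := fun i => ∑ j, l2 (comp Q i j))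
        (fun _ _ => Finset.sum_nonneg fun _ _ => l2_nonneg _) (Finset.mem_univ i)
    linarith [l2_nonneg u]
  · linarith

theorem FieldLe.entriesLe {R : ℝ} {Q : Tensor d J} {u : Scalar d J} (hF : FieldLe R Q u) :
    EntriesLe (max 1 R) Q u :=
  ⟨fun x i j => ((abs_apply_le_l2 (comp Q i j) x).trans (hF.1 i j)).trans (le_max_right _ _),
    fun x => ((abs_apply_le_l2 u x).trans hF.2).trans (le_max_right _ _)⟩

/-- The factor `g` tames the nonlinear terms: their `ℓ²` norms are bounded in terms of an upper
bound of the auxiliary variable alone. -/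
theorem Admissible.exists_weighted_bound (hp : p.Admissible d) (hh : 0 < h) :
    ∃ M : ℝ, 0 ≤ M ∧ ∀ (Q : Tensor d J) (u : Scalar d J) (s E : ℝ), IsQTensor Q → s ≤ E →
      (∀ i j, l2 (p.gFactor h Q u s • comp (p.varQ h Q u) i j) ≤ M * Real.exp E) ∧
      l2 (p.gFactor h Q u s • p.varU h Q u) ≤ M * Real.exp E := by
  obtain ⟨β, -, hβ⟩ := hp.energy1_coercive (J := J) hh
  obtain ⟨c₁, hc₁, H₁⟩ := PolyBound.uniform (ι := Grid d J × Fin d × Fin d)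
    fun y => PolyBound.varQ_entry p h y.1 y.2.1 y.2.2
  obtain ⟨c₂, hc₂, H₂⟩ := PolyBound.uniform fun x : Grid d J => PolyBound.varU_value p h x
  refine ⟨√(Fintype.card (Grid d J)) * ((c₁ + c₂) * Real.exp β), by positivity,
    fun Q u s E hQ hs => ?_⟩
  obtain ⟨ρ, hρ1, hρ, hE⟩ := hβ Q hQ u
  have hρ3 : 0 ≤ ρ ^ 3 := by positivity
  have hg : p.gFactor h Q u s * ρ ^ 3 ≤ Real.exp β * Real.exp E := by
    -- The cubic growth of H and μ is absorbed by e^{ρ³}, which coercivity supplies through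
    -- e^{-E_{1h}} ≤ e^{β - ρ³}.
    have h1 : ρ ^ 3 ≤ Real.exp (ρ ^ 3) := by linarith [Real.add_one_le_exp (ρ ^ 3)]
    calc p.gFactor h Q u s * ρ ^ 3
        ≤ Real.exp (s - p.energy1 h Q u) * Real.exp (ρ ^ 3) := by
          rw [gFactor_eq]
          exact mul_le_mul_of_nonneg_left h1 (Real.exp_pos _).le
      _ ≤ Real.exp β * Real.exp E := by
          rw [← Real.exp_add, ← Real.exp_add, Real.exp_le_exp]
          linarith
  have hg0 := p.gFactor_pos h Q u s
  have key : ∀ {c v : ℝ}, 0 ≤ c → c ≤ c₁ + c₂ → |v| ≤ c * ρ ^ 3 →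
      |p.gFactor h Q u s * v| ≤ (c₁ + c₂) * Real.exp β * Real.exp E := by
    intro c v hc hc' hv
    rw [abs_mul, abs_of_pos hg0]
    calc p.gFactor h Q u s * |v| ≤ p.gFactor h Q u s * (c * ρ ^ 3) :=
          mul_le_mul_of_nonneg_left hv hg0.le
      _ = c * (p.gFactor h Q u s * ρ ^ 3) := by ring
      _ ≤ (c₁ + c₂) * (Real.exp β * Real.exp E) :=
          mul_le_mul hc' hg (mul_nonneg hg0.le hρ3) (by positivity)
      _ = _ := by ring
  rw [mul_assoc]
  constructor
  · intro i j
    exact l2_le_of_abs_le fun x => key hc₁ (by linarith) (H₁ (x, i, j) ρ hρ1 Q u hρ)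
  · exact l2_le_of_abs_le fun x => key hc₂ (by linarith) (H₂ x ρ hρ1 Q u hρ)

/-- Constants controlling one step of the scheme, uniformly in the stabilization constants. -/
structure StepConstants (d J : ℕ) [NeZero J] (p : Params) (h M l D : ℝ) : Prop where
  M_nonneg : 0 ≤ M
  l_nonneg : 0 ≤ l
  D_nonneg : 0 ≤ D
  field : ∀ {E R τ κ₁ κ₂ s : ℝ} {Q : Tensor d J} {u : Scalar d J}, 0 < τ → 0 < κ₁ → 0 < κ₂ →
    IsQTensor Q → s ≤ E → FieldLe R Q u →
    FieldLe (R + τ * (M * Real.exp E + l * R)) (p.stepQ h τ κ₁ Q u s) (p.stepU h τ κ₂ Q u s)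
  aux : ∀ {E R τ κ₁ κ₂ s : ℝ} {Q : Tensor d J} {u : Scalar d J}, 0 < τ → 0 < κ₁ → 0 < κ₂ →
    IsQTensor Q → s ≤ E → FieldLe R Q u →
    |p.provisionalS h Q u s (p.stepQ h τ κ₁ Q u s) (p.stepU h τ κ₂ Q u s) - s|
      ≤ D * (M * Real.exp E) * (τ * (M * Real.exp E + l * R))

theorem Admissible.exists_stepConstants (hp : p.Admissible d) (hh : 0 < h) :
    ∃ M l D : ℝ, StepConstants d J p h M l D := by
  obtain ⟨M, hM, HM⟩ := hp.exists_weighted_bound (J := J) hh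
  obtain ⟨b, ev, hb⟩ := exists_laplaceBasis (d := d) (J := J) h
  have hB := hp.B0_pos
  have hlQ : ∀ i, 0 ≤ p.K * ev i := fun i => mul_nonneg hp.K_pos.le (hb.nonneg i)
  have hlU : ∀ i, 0 ≤ 2 * p.B0 * ev i ^ 2 := fun i => by positivity
  -- The sum of all eigenvalues of -KΔ_h and 2B₀Δ_h² serves as a common upper bound for each of
  -- them.
  set l := ∑ i, (p.K * ev i + 2 * p.B0 * ev i ^ 2) with hl
  have hsingle : ∀ i, p.K * ev i + 2 * p.B0 * ev i ^ 2 ≤ l := fun i =>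
    Finset.single_le_sum (f := fun i => p.K * ev i + 2 * p.B0 * ev i ^ 2)
      (fun j _ => add_nonneg (hlQ j) (hlU j)) (Finset.mem_univ i)
  have hmaxQ : ∀ i, p.K * ev i ≤ l := fun i => by linarith [hsingle i, hlU i]
  have hmaxU : ∀ i, 2 * p.B0 * ev i ^ 2 ≤ l := fun i => by linarith [hsingle i, hlQ i]
  have hl0 : 0 ≤ l := Finset.sum_nonneg fun j _ => add_nonneg (hlQ j) (hlU j)
  have incQ : ∀ {E R τ κ₁ s : ℝ} {Q : Tensor d J} {u : Scalar d J}, 0 < τ → 0 < κ₁ →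
      IsQTensor Q → s ≤ E → FieldLe R Q u → ∀ i j,
      l2 (comp (p.stepQ h τ κ₁ Q u s) i j - comp Q i j) ≤ τ * (M * Real.exp E + l * R) := by
    intro E R τ κ₁ s Q u hτ hκ₁ hQ hs hF i j
    refine (hb.step_increment_le (hb.apply_opQ p.K) hlQ
      hmaxQ (mul_pos (p.gFactor_pos h Q u s) hκ₁) hτ
      (p.comp_stepQ h τ κ₁ Q u s i j)).trans (mul_le_mul_of_nonneg_left ?_ hτ.le)
    exact add_le_add ((HM Q u s E hQ hs).1 i j) (mul_le_mul_of_nonneg_left (hF.1 i j) hl0)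
  have incU : ∀ {E R τ κ₂ s : ℝ} {Q : Tensor d J} {u : Scalar d J}, 0 < τ → 0 < κ₂ →
      IsQTensor Q → s ≤ E → FieldLe R Q u →
      l2 (p.stepU h τ κ₂ Q u s - u) ≤ τ * (M * Real.exp E + l * R) := by
    intro E R τ κ₂ s Q u hτ hκ₂ hQ hs hF
    refine (hb.step_increment_le (hb.apply_opU (2 * p.B0)) hlU
      hmaxU (mul_pos (p.gFactor_pos h Q u s) hκ₂) hτ
      (p.stepU_eq h τ κ₂ Q u s)).trans (mul_le_mul_of_nonneg_left ?_ hτ.le)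
    exact add_le_add (HM Q u s E hQ hs).2 (mul_le_mul_of_nonneg_left hF.2 hl0)
  -- D counts the inner products in s̃ - s, each with weight h^d: d² tensor components and one
  -- scalar field.
  refine ⟨M, l, ∑ _i : Fin d, ∑ _j : Fin d, h ^ d + h ^ d, hM, hl0, by positivity, ?_, ?_⟩
  · intro E R τ κ₁ κ₂ s Q u hτ hκ₁ hκ₂ hQ hs hF
    have hsub : ∀ U V : Scalar d J, l2 U ≤ l2 V + l2 (U - V) := fun U V => by
      simpa using l2_add_le V (U - V)
    exact ⟨fun i j => (hsub _ (comp Q i j)).trans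
        (add_le_add (hF.1 i j) (incQ hτ hκ₁ hQ hs hF i j)),
      (hsub _ u).trans (add_le_add hF.2 (incU hτ hκ₂ hQ hs hF))⟩
  · intro E R τ κ₁ κ₂ s Q u hτ hκ₁ hκ₂ hQ hs hF
    set δ := τ * (M * Real.exp E + l * R)
    have hME : 0 ≤ M * Real.exp E := by positivity
    have hdot : ∀ {U V : Scalar d J}, l2 U ≤ M * Real.exp E → l2 V ≤ δ →
        |h ^ d * (U ⬝ᵥ V)| ≤ h ^ d * (M * Real.exp E * δ) := by
      intro U V hU hV
      rw [abs_mul, abs_of_nonneg (by positivity : 0 ≤ h ^ d)]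
      exact mul_le_mul_of_nonneg_left ((abs_dotProduct_le U V).trans
        (mul_le_mul hU hV (l2_nonneg _) hME)) (by positivity)
    have hprov : p.provisionalS h Q u s (p.stepQ h τ κ₁ Q u s) (p.stepU h τ κ₂ Q u s) - s =
        ∑ i, ∑ j, h ^ d * ((p.gFactor h Q u s • comp (p.varQ h Q u) i j)
          ⬝ᵥ (comp (p.stepQ h τ κ₁ Q u s) i j - comp Q i j))
        + h ^ d * ((p.gFactor h Q u s • p.varU h Q u) ⬝ᵥ (p.stepU h τ κ₂ Q u s - u)) := by
      rw [provisionalS, innerT_eq, inner_eq, add_sub_cancel_left, mul_add, Finset.mul_sum]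
      simp only [Finset.mul_sum, smul_dotProduct, smul_eq_mul, mul_left_comm]
      rfl
    rw [hprov]
    refine (abs_add_le _ _).trans ?_
    rw [mul_assoc, add_mul]
    refine add_le_add ?_ (hdot (HM Q u s E hQ hs).2 (incU hτ hκ₂ hQ hs hF))
    simp only [Finset.sum_mul]
    refine (Finset.abs_sum_le_sum_abs _ _).trans (Finset.sum_le_sum fun i _ => ?_)
    refine (Finset.abs_sum_le_sum_abs _ _).trans (Finset.sum_le_sum fun j _ => ?_)
    exact hdot ((HM Q u s E hQ hs).1 i j) (incQ hτ hκ₁ hQ hs hF i j)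

end Params

/-! ### A priori bounds along a numerical solution. -/

namespace Params

variable {p : Params} {h η₀ τ κ₁ κ₂ : ℝ} {Q₀ : Tensor d J} {u₀ : Scalar d J}
  {Q : ℕ → Tensor d J} {u : ℕ → Scalar d J} {s : ℕ → ℝ} {M l D : ℝ}

theorem Admissible.energy1_bddBelow (hp : p.Admissible d) (hh : 0 < h) :
    ∃ β : ℝ, 0 ≤ β ∧ ∀ Q : Tensor d J, IsQTensor Q → ∀ u : Scalar d J,
      -β ≤ p.energy1 h Q u := by
  obtain ⟨β, hβ0, hβ⟩ := hp.energy1_coercive (J := J) hh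
  refine ⟨β, hβ0, fun Q hQ u => ?_⟩
  obtain ⟨ρ, hρ1, -, hE⟩ := hβ Q hQ u
  have : 0 ≤ ρ ^ 3 := by positivity
  linarith

theorem IsNumericalSolution.aux_le (hp : p.Admissible d) (hh : 0 < h)
    (hη₀ : η₀ ∈ Set.Icc (0 : ℝ) 1) (hτ : 0 < τ) (hτ1 : τ ≤ 1) (hκ₁ : 0 < κ₁) (hκ₂ : 0 < κ₂)
    (hsol : p.IsNumericalSolution h η₀ τ κ₁ κ₂ Q₀ u₀ Q u s) (n : ℕ) :
    s n ≤ p.modEnergy h Q₀ u₀ (p.energy1 h Q₀ u₀) := by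
  refine (hp.le_modEnergy hh (Q n) (u n) (s n)).trans ?_
  induction n with
  | zero => rw [hsol.init_Q, hsol.init_u, hsol.init_s]
  | succ n ih =>
    obtain ⟨ξ, -, -, hs⟩ := hsol.step_s n
    exact (hp.modEnergy_step_le hh hη₀ hτ hτ1 hκ₁ hκ₂ (hsol.step_Q n) (hsol.step_u n) hs).trans ih

/-- Discrete Gronwall inequality: X_{n+1} ≤ (1 + τl)X_n + τF with 1 + τl ≤ e^{lτ}. -/
theorem IsNumericalSolution.fieldLe (hd : d ≠ 0) (hC : StepConstants d J p h M l D)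
    (hτ : 0 < τ) (hκ₁ : 0 < κ₁) (hκ₂ : 0 < κ₂)
    (hsol : p.IsNumericalSolution h η₀ τ κ₁ κ₂ Q₀ u₀ Q u s) (hQ₀ : IsQTensor Q₀)
    {E R : ℝ} (hR : 0 ≤ R) (h0 : FieldLe R Q₀ u₀) (hE : ∀ n, s n ≤ E) (n : ℕ) :
    FieldLe (Real.exp (l * (n * τ)) * (R + n * τ * (M * Real.exp E))) (Q n) (u n) := by
  have hM := hC.M_nonneg
  have hl := hC.l_nonneg
  induction n with
  | zero => simpa [hsol.init_Q, hsol.init_u] using h0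
  | succ n ih =>
    have h1 := hC.field hτ hκ₁ hκ₂ (hsol.isQTensor hd hQ₀ n) (hE n) ih
    rw [← hsol.step_Q, ← hsol.step_u] at h1
    refine h1.mono ?_
    set F := M * Real.exp E
    have hF : 0 ≤ F := by positivity
    set X := Real.exp (l * (n * τ)) * (R + n * τ * F) with hX
    have hX0 : 0 ≤ X := by positivity
    have e1 : 1 + τ * l ≤ Real.exp (l * τ) := by linarith [Real.add_one_le_exp (l * τ)]
    have e2 : Real.exp (l * ((n + 1 : ℕ) * τ)) = Real.exp (l * τ) * Real.exp (l * (n * τ)) := by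
      rw [← Real.exp_add]
      congr 1
      push_cast
      ring
    have e3 : 1 ≤ Real.exp (l * τ) * Real.exp (l * (n * τ)) := by
      rw [← e2]
      exact Real.one_le_exp (by positivity)
    rw [e2]
    have e4 := mul_le_mul_of_nonneg_right e1 hX0
    have e5 := le_mul_of_one_le_left (mul_nonneg hτ.le hF) e3
    push_cast
    calc X + τ * (F + l * X) = (1 + τ * l) * X + τ * F := by ring
      _ ≤ Real.exp (l * τ) * X + Real.exp (l * τ) * Real.exp (l * (n * τ)) * (τ * F) :=
          add_le_add e4 e5
      _ = _ := by rw [hX]; ring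

/-- By induction both s̃ⁿ⁺¹ and E_{1h} lie above the same linearly decreasing bound, hence so does
their convex combination, for any ξ in [0, 1]. -/
theorem IsNumericalSolution.le_aux (hd : d ≠ 0) (hC : StepConstants d J p h M l D)
    (hτ : 0 < τ) (hκ₁ : 0 < κ₁) (hκ₂ : 0 < κ₂)
    (hsol : p.IsNumericalSolution h η₀ τ κ₁ κ₂ Q₀ u₀ Q u s) (hQ₀ : IsQTensor Q₀)
    {E R β T : ℝ} (hβ0 : 0 ≤ β) (hβ : ∀ Q : Tensor d J, IsQTensor Q → ∀ u : Scalar d J,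
      -β ≤ p.energy1 h Q u) (hR : 0 ≤ R) (hE : ∀ n, s n ≤ E)
    (hF : ∀ n : ℕ, n * τ ≤ T → FieldLe R (Q n) (u n)) (n : ℕ) (hn : n * τ ≤ T) :
    -(|s 0| + β) - n * τ * (D * (M * Real.exp E) * (M * Real.exp E + l * R)) ≤ s n := by
  have hM := hC.M_nonneg
  have hl := hC.l_nonneg
  have hD := hC.D_nonneg
  set W := D * (M * Real.exp E) * (M * Real.exp E + l * R) with hW
  have hW0 : 0 ≤ W := by positivity
  induction n with
  | zero =>
    push_cast
    linarith [neg_abs_le (s 0)]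
  | succ n ih =>
    push_cast at hn ⊢
    have hn' : n * τ ≤ T := by linarith
    have ih := ih hn'
    obtain ⟨ξ, hξ, hs, -⟩ := hsol.step_s n
    have h1 := hC.aux hτ hκ₁ hκ₂ (hsol.isQTensor hd hQ₀ n) (hE n) (hF n hn')
    rw [← hsol.step_Q, ← hsol.step_u] at h1
    have h2 : s n - τ * W ≤ p.provisionalS h (Q n) (u n) (s n) (Q (n + 1)) (u (n + 1)) := by
      have := (abs_le.mp h1).1
      rw [hW]
      linarith
    have h3 := hβ (Q (n + 1)) (hsol.isQTensor hd hQ₀ (n + 1)) (u (n + 1))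
    have h4 : 0 ≤ (n + 1 : ℝ) * τ * W := by positivity
    set m := -(|s 0| + β) - (n + 1) * τ * W with hm
    have a1 : m ≤ p.provisionalS h (Q n) (u n) (s n) (Q (n + 1)) (u (n + 1)) := by linarith
    have a2 : m ≤ p.energy1 h (Q (n + 1)) (u (n + 1)) := by linarith [abs_nonneg (s 0)]
    have b1 := mul_le_mul_of_nonneg_left a1 hξ.1
    have b2 := mul_le_mul_of_nonneg_left a2 (sub_nonneg.mpr hξ.2)
    rw [hs]
    linarith

/-- Bounds of the numerical solutions with `τ ≤ 1`, by the modified energy law. -/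
theorem Admissible.exists_bound_of_le_one (hp : p.Admissible d) (hh : 0 < h)
    (hη₀ : η₀ ∈ Set.Icc (0 : ℝ) 1) (hQ₀ : IsQTensor Q₀) (u₀ : Scalar d J) {T : ℝ} (hT : 0 < T) :
    ∃ R : ℝ, ∀ τ κ₁ κ₂ : ℝ, 0 < τ → 0 < κ₁ → 0 < κ₂ → τ ≤ 1 →
      ∀ (Q : ℕ → Tensor d J) (u : ℕ → Scalar d J) (s : ℕ → ℝ),
      p.IsNumericalSolution h η₀ τ κ₁ κ₂ Q₀ u₀ Q u s → ∀ n : ℕ, n * τ ≤ T →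
      FieldLe R (Q n) (u n) ∧ |s n| ≤ R := by
  obtain ⟨M, l, D, hC⟩ := hp.exists_stepConstants (J := J) hh
  obtain ⟨β, hβ0, hβ⟩ := hp.energy1_bddBelow (J := J) hh
  obtain ⟨R₀, hR₀, hF₀⟩ := exists_fieldLe Q₀ u₀
  have hM := hC.M_nonneg
  have hl := hC.l_nonneg
  have hD := hC.D_nonneg
  set E := p.modEnergy h Q₀ u₀ (p.energy1 h Q₀ u₀)
  set R₁ := Real.exp (l * T) * (R₀ + T * (M * Real.exp E)) with hR₁
  have hR₁0 : 0 ≤ R₁ := by positivity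
  set W := D * (M * Real.exp E) * (M * Real.exp E + l * R₁) with hW
  have hW0 : 0 ≤ W := by positivity
  refine ⟨R₁ + |E| + |p.energy1 h Q₀ u₀| + β + T * W, fun τ κ₁ κ₂ hτ hκ₁ hκ₂ hτ1 Q u s hsol n hn => ?_⟩
  have hE := hsol.aux_le hp hh hη₀ hτ hτ1 hκ₁ hκ₂
  have hF : ∀ n : ℕ, n * τ ≤ T → FieldLe R₁ (Q n) (u n) := by
    intro n hn
    refine (hsol.fieldLe hp.dim_ne_zero hC hτ hκ₁ hκ₂ hQ₀ hR₀ hF₀ hE n).mono ?_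
    rw [hR₁]
    gcongr
  have hs := hsol.le_aux hp.dim_ne_zero hC hτ hκ₁ hκ₂ hQ₀ hβ0 hβ hR₁0 hE hF n hn
  rw [← hW, hsol.init_s] at hs
  have hTW : n * τ * W ≤ T * W := mul_le_mul_of_nonneg_right hn hW0
  have hTW0 : 0 ≤ T * W := by positivity
  have a1 := abs_nonneg E
  have a2 := abs_nonneg (p.energy1 h Q₀ u₀)
  refine ⟨(hF n hn).mono (by linarith), abs_le.mpr ⟨by linarith, ?_⟩⟩
  linarith [hE n, le_abs_self E]

/-- Bounds of the numerical solutions at a fixed level, without restriction of the time step. -/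
theorem Admissible.exists_bound_at_level (hp : p.Admissible d) (hh : 0 < h)
    (hQ₀ : IsQTensor Q₀) (u₀ : Scalar d J) (η₀ : ℝ) {T : ℝ} (n : ℕ) :
    ∃ R : ℝ, 0 ≤ R ∧ ∀ τ κ₁ κ₂ : ℝ, 0 < τ → 0 < κ₁ → 0 < κ₂ →
      ∀ (Q : ℕ → Tensor d J) (u : ℕ → Scalar d J) (s : ℕ → ℝ),
      p.IsNumericalSolution h η₀ τ κ₁ κ₂ Q₀ u₀ Q u s → n * τ ≤ T →
      FieldLe R (Q n) (u n) ∧ |s n| ≤ R := by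
  induction n with
  | zero =>
    obtain ⟨R₀, hR₀, hF₀⟩ := exists_fieldLe Q₀ u₀
    refine ⟨R₀ + |p.energy1 h Q₀ u₀|, by positivity, ?_⟩
    intro τ κ₁ κ₂ _ _ _ Q u s hsol _
    rw [hsol.init_Q, hsol.init_u, hsol.init_s]
    exact ⟨hF₀.mono (by linarith [abs_nonneg (p.energy1 h Q₀ u₀)]), by linarith⟩
  | succ n ih =>
    obtain ⟨R, hR, ih⟩ := ih
    obtain ⟨M, l, D, hC⟩ := hp.exists_stepConstants (J := J) hh
    obtain ⟨c, hc, hE⟩ := p.energy1_polyBound (d := d) (J := J) h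
    have hM := hC.M_nonneg
    have hl := hC.l_nonneg
    have hD := hC.D_nonneg
    set F := M * Real.exp R with hF
    have hF0 : 0 ≤ F := by positivity
    -- δ bounds the increment of each field component, P bounds |s̃| and V bounds |E_{1h}| at level
    -- n + 1. The upper bound of s comes from the previous level, so its growth with n is harmless.
    set δ := |T| * (F + l * R) with hδ
    have hδ0 : 0 ≤ δ := by positivity
    set P := R + D * F * δ with hP
    have hP0 : 0 ≤ P := by positivity
    set V := c * max 1 (R + δ) ^ 4 with hV
    have hV0 : 0 ≤ V := by positivity
    refine ⟨R + δ + P + V, by positivity, ?_⟩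
    intro τ κ₁ κ₂ hτ hκ₁ hκ₂ Q u s hsol hn
    push_cast at hn
    have hnτ : 0 ≤ n * τ := by positivity
    -- From (n + 1)τ ≤ T; at levels n ≥ 1 the step itself is bounded, although τ may exceed 1.
    have hτT : τ ≤ |T| := le_trans (by linarith) (le_abs_self T)
    obtain ⟨hFn, hsn⟩ := ih τ κ₁ κ₂ hτ hκ₁ hκ₂ Q u s hsol (by linarith)
    have hQn := hsol.isQTensor hp.dim_ne_zero hQ₀ n
    have hsR : s n ≤ R := (le_abs_self _).trans hsn
    have hinc : τ * (F + l * R) ≤ δ := mul_le_mul_of_nonneg_right hτT (by positivity)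
    have h1 := (hC.field hτ hκ₁ hκ₂ hQn hsR hFn).mono
      (add_le_add le_rfl hinc)
    have h2 := hC.aux hτ hκ₁ hκ₂ hQn hsR hFn
    rw [← hsol.step_Q, ← hsol.step_u] at h1 h2
    have h3 := hE _ (le_max_left _ _) _ _ h1.entriesLe
    have h4 : |p.provisionalS h (Q n) (u n) (s n) (Q (n + 1)) (u (n + 1))| ≤ P := by
      have h5 := h2.trans (mul_le_mul_of_nonneg_left hinc (by positivity))
      have h6 := abs_sub_abs_le_abs_sub
        (p.provisionalS h (Q n) (u n) (s n) (Q (n + 1)) (u (n + 1))) (s n)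
      linarith
    obtain ⟨ξ, hξ, hs, -⟩ := hsol.step_s n
    refine ⟨h1.mono (by linarith), ?_⟩
    rw [hs]
    refine (abs_add_le _ _).trans ?_
    rw [abs_mul, abs_mul, abs_of_nonneg hξ.1, abs_of_nonneg (sub_nonneg.mpr hξ.2)]
    have b1 := (mul_le_of_le_one_left (abs_nonneg _) hξ.2).trans h4
    have b2 := (mul_le_of_le_one_left (abs_nonneg _) (by linarith [hξ.1] : 1 - ξ ≤ 1)).trans h3
    linarith

theorem Admissible.exists_bound (hp : p.Admissible d) (hh : 0 < h)
    (hη₀ : η₀ ∈ Set.Icc (0 : ℝ) 1) (hQ₀ : IsQTensor Q₀) (u₀ : Scalar d J) {T : ℝ} (hT : 0 < T) :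
    ∃ R : ℝ, ∀ τ κ₁ κ₂ : ℝ, 0 < τ → 0 < κ₁ → 0 < κ₂ →
      ∀ (Q : ℕ → Tensor d J) (u : ℕ → Scalar d J) (s : ℕ → ℝ),
      p.IsNumericalSolution h η₀ τ κ₁ κ₂ Q₀ u₀ Q u s → ∀ n : ℕ, n * τ ≤ T →
      FieldLe R (Q n) (u n) ∧ |s n| ≤ R := by
  obtain ⟨R₁, H₁⟩ := hp.exists_bound_of_le_one hh hη₀ hQ₀ u₀ hT
  choose R₂ hR₂ H₂ using hp.exists_bound_at_level hh hQ₀ u₀ η₀ (T := T)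
  have hsum : 0 ≤ ∑ m ∈ Finset.range (⌊T⌋₊ + 1), R₂ m := Finset.sum_nonneg fun m _ => hR₂ m
  refine ⟨|R₁| + ∑ m ∈ Finset.range (⌊T⌋₊ + 1), R₂ m, ?_⟩
  intro τ κ₁ κ₂ hτ hκ₁ hκ₂ Q u s hsol n hn
  rcases le_total τ 1 with h1 | h1
  · obtain ⟨hF, hs⟩ := H₁ τ κ₁ κ₂ hτ hκ₁ hκ₂ h1 Q u s hsol n hn
    have hle : R₁ ≤ |R₁| + ∑ m ∈ Finset.range (⌊T⌋₊ + 1), R₂ m := by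
      linarith [le_abs_self R₁]
    exact ⟨hF.mono hle, hs.trans hle⟩
  · obtain ⟨hF, hs⟩ := H₂ n τ κ₁ κ₂ hτ hκ₁ hκ₂ Q u s hsol hn
    -- With τ ≥ 1 only the levels 0, …, ⌊T⌋ occur, so a finite sum of the levelwise bounds suffices.
    have hnT : (n : ℝ) ≤ T := (le_mul_of_one_le_right (Nat.cast_nonneg n) h1).trans hn
    have hmem : n ∈ Finset.range (⌊T⌋₊ + 1) :=
      Finset.mem_range.mpr (Nat.lt_succ_of_le (Nat.le_floor hnT))
    have hle : R₂ n ≤ |R₁| + ∑ m ∈ Finset.range (⌊T⌋₊ + 1), R₂ m := by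
      have := Finset.single_le_sum (fun m _ => hR₂ m) hmem
      linarith [abs_nonneg R₁]
    exact ⟨hF.mono hle, hs.trans hle⟩

/-! ### From bounds of the state to the constants of the maximum bound principle. -/

theorem exists_levelBounds (p : Params) (h R : ℝ) :
    ∃ G S Amax : ℝ, 0 < G ∧ ∀ (Q : Tensor d J) (u : Scalar d J) (s : ℝ),
      FieldLe R Q u → |s| ≤ R → p.LevelBounds h G S Amax Q u s := by
  have hfsq : ∀ x : Grid d J, PolyBound 4 (fun (_ : Tensor d J) u =>
      ∑ i, ∑ j, p.forcing h u x i j ^ 2) := fun x =>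
    PolyBound.sum _ fun i => PolyBound.sum _ fun j => (PolyBound.forcing_entry p h x i j).pow 2
  obtain ⟨c₁, -, H₁⟩ := PolyBound.uniform hfsq
  obtain ⟨c₂, -, H₂⟩ := PolyBound.uniform fun x : Grid d J => PolyBound.aTilde p x
  obtain ⟨c₃, -, H₃⟩ := p.energy1_polyBound (d := d) (J := J) h
  -- g = e^{s - E_{1h}} is smallest when s = -R and E_{1h} takes its polynomial upper bound; the
  -- forcing is bounded through its squared Frobenius norm, of degree four in u.
  refine ⟨Real.exp (-R - c₃ * max 1 R ^ 4), √(c₁ * max 1 R ^ 4), c₂ * max 1 R ^ 2,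
    Real.exp_pos _, fun Q u s hF hs => ⟨?_, ?_, fun x => ?_⟩⟩
  · rw [gFactor_eq, Real.exp_le_exp]
    have h1 := (abs_le.mp (H₃ _ (le_max_left 1 R) Q u hF.entriesLe)).2
    linarith [(abs_le.mp hs).1]
  · rw [supNorm_le_iff]
    intro x
    exact Real.sqrt_le_sqrt ((le_abs_self _).trans (H₁ x _ (le_max_left 1 R) Q u hF.entriesLe))
  · exact (le_abs_self _).trans (H₂ x _ (le_max_left 1 R) Q u hF.entriesLe)

theorem Admissible.exists_uniform_levelBounds (hp : p.Admissible d) (hh : 0 < h)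
    (hη₀ : η₀ ∈ Set.Icc (0 : ℝ) 1) (hQ₀ : IsQTensor Q₀) (u₀ : Scalar d J) {T : ℝ} (hT : 0 < T) :
    ∃ G S Amax : ℝ, 0 < G ∧ ∀ τ κ₁ κ₂ : ℝ, 0 < τ → 0 < κ₁ → 0 < κ₂ →
      ∀ (Q : ℕ → Tensor d J) (u : ℕ → Scalar d J) (s : ℕ → ℝ),
      p.IsNumericalSolution h η₀ τ κ₁ κ₂ Q₀ u₀ Q u s → ∀ n : ℕ, n * τ ≤ T →
      p.LevelBounds h G S Amax (Q n) (u n) (s n) := by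
  obtain ⟨R, HR⟩ := hp.exists_bound hh hη₀ hQ₀ u₀ hT
  obtain ⟨G, S, Amax, hG, H⟩ := p.exists_levelBounds (d := d) (J := J) h R
  refine ⟨G, S, Amax, hG, fun τ κ₁ κ₂ hτ hκ₁ hκ₂ Q u s hsol n hn => ?_⟩
  obtain ⟨hF, hs⟩ := HR τ κ₁ κ₂ hτ hκ₁ hκ₂ Q u s hsol n hn
  exact H _ _ _ hF hs

end Params

end

end Smectic

theorem theorem4p5 {d J : ℕ} [NeZero J] (p : Smectic.Params) (hp : p.Admissible d)
    (Ld : ℝ) (hLd : 0 < Ld) (η₀ : ℝ) (hη₀ : η₀ ∈ Set.Icc (0 : ℝ) 1)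
    (Q₀ : Smectic.Tensor d J) (hQ₀ : Smectic.IsQTensor Q₀) (u₀ : Smectic.Scalar d J) :
    -- constants `G`, `S`, `Amax` independent of `τ`, `κ₁`, `κ₂` and `n` exist on every `[0, T]`
    (∀ T : ℝ, 0 < T → ∃ G S Amax : ℝ, 0 < G ∧
      ∀ τ κ₁ κ₂ : ℝ, 0 < τ → 0 < κ₁ → 0 < κ₂ →
      ∀ (Q : ℕ → Smectic.Tensor d J) (u : ℕ → Smectic.Scalar d J) (s : ℕ → ℝ),
        p.IsNumericalSolution (Ld / J) η₀ τ κ₁ κ₂ Q₀ u₀ Q u s →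
        ∀ n : ℕ, n * τ ≤ T → p.LevelBounds (Ld / J) G S Amax (Q n) (u n) (s n)) ∧
    -- every sufficiently large `η` satisfies `f_d(η) ≤ 0`
    (∀ S : ℝ, ∃ ηmin : ℝ, 0 < ηmin ∧ ∀ η : ℝ, ηmin ≤ η → p.fPoly d S η ≤ 0) ∧
    -- maximum bound principle, for every time step `τ`, on every finite or infinite range of `n`
    (∀ τ κ₁ κ₂ : ℝ, 0 < τ → 0 < κ₁ → 0 < κ₂ →
      ∀ (Q : ℕ → Smectic.Tensor d J) (u : ℕ → Smectic.Scalar d J) (s : ℕ → ℝ),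
        p.IsNumericalSolution (Ld / J) η₀ τ κ₁ κ₂ Q₀ u₀ Q u s →
      ∀ (N : ℕ∞) (G S Amax η : ℝ), 0 < G →
        (∀ n : ℕ, (n : ℕ∞) < N → p.LevelBounds (Ld / J) G S Amax (Q n) (u n) (s n)) →
        0 < η → p.fPoly d S η ≤ 0 → Smectic.supNorm Q₀ ≤ η →
        p.kappa0 d Amax η / G ≤ κ₁ →
        ∀ n : ℕ, (n : ℕ∞) ≤ N → Smectic.supNorm (Q n) ≤ η) := by
  have hh : 0 < Ld / J := div_pos hLd (Nat.cast_pos.mpr (NeZero.pos J))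
  refine ⟨fun T hT => hp.exists_uniform_levelBounds hh hη₀ hQ₀ u₀ hT, hp.exists_fPoly_nonpos, ?_⟩
  intro τ κ₁ κ₂ hτ hκ₁ _ Q u s hsol N G S Amax η hG hb hη hf hQη hκ n hn
  exact hsol.supNorm_le hp hQ₀ hτ hκ₁ hG hb hη hf hQη hκ n hn
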